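/- **Setting.** Let $\mathbb G$ be a connected, simply connected Lie group of dimension $n$ whose Lie algebra has a positive grading $\mathfrak g=\bigoplus_{w\ge 1}\mathfrak g_w$, $[\mathfrak g_v,\mathfrak g_w]\subseteq\mathfrak g_{v+w}$ ($w$ positive integers), and fix a scalar product on $\mathfrak g$ for which different layers are orthogonal, extended canonically to $\bigwedge^\bullet\mathfrak g^*$. Identify $\Omega^k(\mathbb G)$ with $C^\infty(\mathbb G)\otimes\bigwedge^k\mathfrak g^*$. Let $d$ be the exterior derivative and let $d_0$ be the $C^\infty(\mathbb G)$-linear operator with $d_0(f\xi)=f\,d\xi$ for $\xi$ left-invariant, so that $d=d_0+\sum_{w\ge1}d_w$ with $d_w(f\xi)=\sum_{l:\,X_l\in\mathfrak g_w}(X_lf)\,\theta_l\wedge\xi$, where $(X_l)$ is a graded basis of $\mathfrak g$ and $(\theta_l)$ its dual basis. Let $\delta_0$ be the adjoint of $d_0$, let $d_0^{-1}$ be the partial inverse of $d_0$ (the orthogonal projection onto $\operatorname{Im}d_0$ followed by the inverse of $d_0\colon(\ker d_0)^\perp\to\operatorname{Im}d_0$), all taken $C^\infty(\mathbb G)$-linearly,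 and put $$E_0^k=\ker d_0\cap\ker\delta_0\cap\Omega^k(\mathbb G),\qquad \Pi_0=\mathrm{Id}-d_0d_0^{-1}-d_0^{-1}d_0,\qquad P=d_0^{-1}(d-d_0),\qquad b=d_0^{-1}d_0-d_0^{-1}d=-P,$$ $$\Pi=(\mathrm{Id}-b)^{-1}d_0^{-1}d+d(\mathrm{Id}-b)^{-1}d_0^{-1},\qquad \Pi_E=\mathrm{Id}-\Pi,\qquad d_c=\Pi_0\,d\,\Pi_E\ \text{ on } E_0^\bullet,$$ $$\partial_r=d_r-\sum_{j=1}^{r-1}d_{r-j}\,d_0^{-1}\partial_j\qquad(r\ge1).$$ The recursive use of the Leibniz rule on $d\alpha$ is the following procedure. Start with $\eta_0=0$, $\zeta_0=0$, $\rho_0=d\alpha$. Given $(\eta_m,\zeta_m,\rho_m)$, split $\rho_m=d_0d_0^{-1}\rho_m+\Pi_0\rho_m+d_0^{-1}d_0\rho_m$, and apply the Leibniz rule in the form $d_0\beta=d\beta-(d-d_0)\beta$ with $\beta=d_0^{-1}\rho_m$, that is, set $$\eta_{m+1}=\eta_m+d_0^{-1}\rho_m,\qquad \zeta_{m+1}=\zeta_m+\Pi_0\rho_m+d_0^{-1}d_0\rho_m,\qquad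 \rho_{m+1}=-(d-d_0)d_0^{-1}\rho_m .$$ **Proposition (the Rumin complex from the Leibniz rule).** The operator $\mathrm{Id}-b$ is invertible, and there is an $N\in\mathbb N$, depending only on $\mathbb G$ with its grading and scalar product, such that $P^{N+1}=0$ and $\partial_r=0$ for all $r>N$. Let $k\ge1$ and let $\alpha\in E_0^{k-1}$ be a Rumin form. Then $d\alpha=d\eta_m+\zeta_m+\rho_m$ for every $m\ge 0$. Moreover, for every $N\in\mathbb N$ with $P^{N+1}\alpha=0$ and $\partial_r\alpha=0$ for all $r>N$, the following hold. 1. $\rho_{N+1}=0$. 2. $\eta_{N+1}=\sum_{i=0}^{N}(-1)^iP^{i+1}\alpha\in\operatorname{Im}\delta_0$ and $\Pi_E\alpha=\alpha-\eta_{N+1}$. 3. $(d-d_0)\sum_{i=0}^{N}(-1)^iP^i\alpha=\sum_{i=1}^N\partial_i\alpha$ and $\Pi_0\big(\sum_{i=1}^N\partial_i\alpha\big)=d_c\alpha\in E_0^k$. 4. $\zeta_{N+1}=d_c\alpha+d_0^{-1}d_0\big(\sum_{i=1}^N\partial_i\alpha\big)$, and $$d(\Pi_E\alpha)=d_c\alpha+d_0^{-1}d_0\Big(\sum_{i=1}^N\partial_i\alpha\Big),\qquad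 d_0^{-1}d_0\Big(\sum_{i=1}^N\partial_i\alpha\Big)\in\operatorname{Im}\delta_0 .$$ Thus the Rumin differential $d_c\alpha$ is recovered from the exterior derivative by the Leibniz rule, up to forms in $\operatorname{Im}\delta_0$. -/

import Mathlib

open scoped Manifold ContDiff

noncomputable section

namespace RuminLeibniz

/-! ### Graded Lie algebras, adapted scalar products, left-invariant forms -/

section Algebra

variable {L : Type*} [LieRing L] [LieAlgebra ℝ L]

/-- A positive grading of a real Lie algebra: `L = ⨁_w L_w`, the weights being positive integers
(`layer w = 0` when `w` is not a weight), and `[L_v, L_w] ⊆ L_{v+w}`. -/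
structure PositiveGrading (L : Type*) [LieRing L] [LieAlgebra ℝ L] where
  /-- the layer of weight `w` -/
  layer : ℕ → Submodule ℝ L
  isInternal : DirectSum.IsInternal layer
  layer_zero : layer 0 = ⊥
  lie_mem : ∀ v w x y, x ∈ layer v → y ∈ layer w → ⁅x, y⁆ ∈ layer (v + w)

/-- A scalar product on the Lie algebra adapted to the grading: different layers are
orthogonal. -/
structure AdaptedScalarProduct (gr : PositiveGrading L) where
  /-- the scalar product -/
  form : LinearMap.BilinForm ℝ L
  symm : ∀ x y, form x y = form y x
  pos : ∀ x, x ≠ 0 → 0 < form x x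
  orthogonal : ∀ v w x y, v ≠ w → x ∈ gr.layer v → y ∈ gr.layer w → form x y = 0

/-- The projection `L → L_w ⊆ L` onto the layer of weight `w` along the other layers. -/
def PositiveGrading.proj (gr : PositiveGrading L) (w : ℕ) : L →ₗ[ℝ] L :=
  (gr.layer w).subtype ∘ₗ DirectSum.component ℝ ℕ (fun v => gr.layer v) w ∘ₗ
    (LinearEquiv.ofBijective (DirectSum.coeLinearMap gr.layer) gr.isInternal).symm.toLinearMap

/-- Left-invariant `k`-forms: the covectors `⋀^k L^*`, as alternating `k`-linear forms on `L`. -/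
abbrev Covector (L : Type*) [LieRing L] [LieAlgebra ℝ L] (k : ℕ) : Type _ :=
  L [⋀^Fin k]→ₗ[ℝ] ℝ

/-- The interior product `ι_{[X,Y]} ξ`, bilinear in `X` and `Y`. -/
def bracketContraction {k : ℕ} (ξ : Covector L (k + 1)) : L →ₗ[ℝ] L →ₗ[ℝ] Covector L k :=
  (LieModule.toEnd ℝ L L : L →ₗ[ℝ] Module.End ℝ L).compr₂ ξ.curryLeft

/-- The exterior derivative on left-invariant forms (Chevalley-Eilenberg differential)
`dξ (X_0, …, X_k) = ∑_{i<j} (-1)^{i+j} ξ([X_i, X_j], X_0, …, X̂_i, …, X̂_j, …, X_k)`.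
It is written as the alternatization of `(X, Y) ↦ ι_{[X,Y]} ξ`, where every unordered pair is
counted twice; the formula is `ceDiff_apply` below. -/
def ceDiff : (k : ℕ) → Covector L k →ₗ[ℝ] Covector L (k + 1)
  | 0 => 0
  | k + 1 =>
    { toFun := fun ξ => -(1 / 2 : ℝ) • AlternatingMap.alternatizeUncurryFin
        (AlternatingMap.alternatizeUncurryFinLM ∘ₗ bracketContraction ξ)
      map_add' := fun ξ η => by
        have : bracketContraction (ξ + η) = bracketContraction ξ + bracketContraction η := by
          ext; simp [bracketContraction]
        rw [this, LinearMap.comp_add, AlternatingMap.alternatizeUncurryFin_add, smul_add]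
      map_smul' := fun c ξ => by
        have : bracketContraction (c • ξ) = c • bracketContraction ξ := by
          ext; simp [bracketContraction]
        rw [this, LinearMap.comp_smul, AlternatingMap.alternatizeUncurryFin_smul, smul_comm]
        rfl }

/-- The pair `(i, j)`, `i ≤ j`, in the sum stands for the pair of positions `i < j + 1`, whence the
sign. -/
theorem ceDiff_apply {k : ℕ} (ξ : Covector L (k + 1)) (X : Fin (k + 2) → L) :
    ceDiff (k + 1) ξ X = -∑ i : Fin (k + 1), ∑ j ≥ i, (-1 : ℝ) ^ (i + j : ℕ) *
      ξ (Matrix.vecCons ⁅X i.castSucc, X j.succ⁆ (j.removeNth (i.castSucc.removeNth X))) := by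
  have h : ceDiff (k + 1) ξ X = -(1 / 2 : ℝ) * (AlternatingMap.alternatizeUncurryFin
        (AlternatingMap.alternatizeUncurryFinLM ∘ₗ bracketContraction ξ)) X := rfl
  rw [h, AlternatingMap.alternatizeUncurryFin_alternatizeUncurryFinLM_comp_apply,
    neg_mul, Finset.mul_sum]
  congr 1
  refine Finset.sum_congr rfl fun i _ => ?_
  rw [Finset.mul_sum]
  refine Finset.sum_congr rfl fun j _ => ?_
  have h1 : bracketContraction ξ (X j.succ) (X i.castSucc)
      = -bracketContraction ξ (X i.castSucc) (X j.succ) := by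
    have h2 : ⁅X j.succ, X i.castSucc⁆ = -⁅X i.castSucc, X j.succ⁆ := (lie_skew _ _).symm
    change ξ.curryLeft ⁅X j.succ, X i.castSucc⁆ = -ξ.curryLeft ⁅X i.castSucc, X j.succ⁆
    rw [h2, map_neg]
  rw [h1, AlternatingMap.neg_apply, sub_neg_eq_add, zsmul_eq_mul]
  push_cast
  simp only [bracketContraction, LinearMap.compr₂_apply, AlternatingMap.curryLeft_apply_apply,
    LieHom.coe_toLinearMap, LieModule.toEnd_apply_apply]
  ring

variable [FiniteDimensional ℝ L]

theorem exists_orthonormal_basis {V : Type*} [AddCommGroup V] [Module ℝ V] [FiniteDimensional ℝ V]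
    (B : LinearMap.BilinForm ℝ V) (symm : ∀ x y, B x y = B y x)
    (pos : ∀ x, x ≠ 0 → 0 < B x x) :
    ∃ e : Module.Basis (Fin (Module.finrank ℝ V)) ℝ V,
      ∀ i j, B (e i) (e j) = if i = j then 1 else 0 := by
  let c : InnerProductSpace.Core ℝ V :=
    { inner := fun x y => B x y
      conj_inner_symm := fun x y => by simp [symm x y]
      re_inner_nonneg := fun x => by
        rcases eq_or_ne x 0 with rfl | h
        · simp
        · exact (pos x h).le
      add_left := fun x y z => by simp
      smul_left := fun x y r => by simp
      definite := fun x h => by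
        by_contra hx
        exact (pos x hx).ne' h }
  let _ : NormedAddCommGroup V := c.toNormedAddCommGroup
  let _ : InnerProductSpace ℝ V := InnerProductSpace.ofCore c.toCore
  refine ⟨(stdOrthonormalBasis ℝ V).toBasis, fun i j => ?_⟩
  have := (orthonormal_iff_ite (𝕜 := ℝ)).1 (stdOrthonormalBasis ℝ V).orthonormal i j
  rw [OrthonormalBasis.coe_toBasis]
  exact this

/-- There is a graded orthonormal basis. -/
theorem exists_gradedBasis {gr : PositiveGrading L} (ip : AdaptedScalarProduct gr) :
    ∃ e : Module.Basis (Fin (Module.finrank ℝ L)) ℝ L,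
      (∀ i, ∃ w, e i ∈ gr.layer w) ∧
      ∀ i j, ip.form (e i) (e j) = if i = j then 1 else 0 := by
  have hb : ∀ w, ∃ e : Module.Basis (Fin (Module.finrank ℝ (gr.layer w))) ℝ (gr.layer w),
      ∀ i j, ip.form (e i) (e j) = if i = j then 1 else 0 := fun w =>
    exists_orthonormal_basis (ip.form.restrict (gr.layer w)) (fun x y => ip.symm x y)
      (fun x hx => ip.pos x (by simpa using hx))
  choose b hb using hb
  let e := gr.isInternal.collectedBasis b
  have : Fintype (Σ w, Fin (Module.finrank ℝ (gr.layer w))) :=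
    FiniteDimensional.fintypeBasisIndex e
  let σ := Fintype.equivFinOfCardEq (Module.finrank_eq_card_basis e).symm
  refine ⟨e.reindex σ, fun i => ⟨(σ.symm i).1, ?_⟩, fun i j => ?_⟩
  · rw [Module.Basis.reindex_apply]
    exact gr.isInternal.collectedBasis_mem b _
  · simp only [Module.Basis.reindex_apply, e, DirectSum.IsInternal.collectedBasis_coe]
    have hij : (if i = j then (1 : ℝ) else 0) = if σ.symm i = σ.symm j then 1 else 0 := by simp
    rw [hij]
    generalize σ.symm i = p
    generalize σ.symm j = q
    obtain ⟨v, p⟩ := p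
    obtain ⟨w, q⟩ := q
    rcases eq_or_ne v w with rfl | hvw
    · simp [hb]
    · rw [if_neg (fun h => hvw (congrArg Sigma.fst h))]
      exact ip.orthogonal v w _ _ hvw (b v p).2 (b w q).2

/-- A graded orthonormal basis `(X_1, …, X_n)` of the Lie algebra. -/
def gradedBasis {gr : PositiveGrading L} (ip : AdaptedScalarProduct gr) :
    Module.Basis (Fin (Module.finrank ℝ L)) ℝ L :=
  (exists_gradedBasis ip).choose

theorem gradedBasis_mem {gr : PositiveGrading L} (ip : AdaptedScalarProduct gr)
    (i : Fin (Module.finrank ℝ L)) : ∃ w, gradedBasis ip i ∈ gr.layer w :=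
  (exists_gradedBasis ip).choose_spec.1 i

theorem gradedBasis_orthonormal {gr : PositiveGrading L} (ip : AdaptedScalarProduct gr)
    (i j : Fin (Module.finrank ℝ L)) :
    ip.form (gradedBasis ip i) (gradedBasis ip j) = if i = j then 1 else 0 :=
  (exists_gradedBasis ip).choose_spec.2 i j

instance (k : ℕ) : FiniteDimensional ℝ (Covector L k) :=
  Module.Finite.of_injective
    (AlternatingMap.toMultilinearMapLM : Covector L k →ₗ[ℝ] MultilinearMap ℝ (fun _ => L) ℝ)
    AlternatingMap.coe_multilinearMap_injective

variable {gr : PositiveGrading L} (ip : AdaptedScalarProduct gr)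

/-- The canonical extension of the scalar product to `⋀^k L^*`, for which the covectors
`θ_{i_1} ∧ ⋯ ∧ θ_{i_k}`, `i_1 < ⋯ < i_k`, are orthonormal:
`⟨ξ, η⟩_k = ∑_{i_1 < ⋯ < i_k} ξ(X_{i_1}, …, X_{i_k}) η(X_{i_1}, …, X_{i_k})`, the sum being written
as `1 / k!` times the sum over all multi-indices. -/
def covectorForm (k : ℕ) : LinearMap.BilinForm ℝ (Covector L k) :=
  LinearMap.mk₂ ℝ (fun ξ η => (k.factorial : ℝ)⁻¹ *
      ∑ i : Fin k → Fin (Module.finrank ℝ L),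
        ξ (fun a => gradedBasis ip (i a)) * η (fun a => gradedBasis ip (i a)))
    (fun ξ ξ' η => by simp [add_mul, Finset.sum_add_distrib, mul_add])
    (fun c ξ η => by simp only [AlternatingMap.smul_apply, smul_eq_mul, mul_assoc,
      ← Finset.mul_sum]; ring)
    (fun ξ η η' => by simp [mul_add, Finset.sum_add_distrib])
    (fun c ξ η => by
      simp only [AlternatingMap.smul_apply, smul_eq_mul, mul_left_comm _ c, ← Finset.mul_sum])

theorem covectorForm_apply (k : ℕ) (ξ η : Covector L k) :
    covectorForm ip k ξ η = (k.factorial : ℝ)⁻¹ * ∑ i : Fin k → Fin (Module.finrank ℝ L),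
      ξ (fun a => gradedBasis ip (i a)) * η (fun a => gradedBasis ip (i a)) := rfl

theorem covectorForm_isSymm (k : ℕ) : (covectorForm ip k).IsSymm :=
  ⟨fun ξ η => by simp [covectorForm_apply, mul_comm]⟩

theorem eq_zero_of_covectorForm_self (k : ℕ) (ξ : Covector L k) (h : covectorForm ip k ξ ξ = 0) :
    ξ = 0 := by
  rw [covectorForm_apply, mul_eq_zero] at h
  rcases h with h | h
  · exact absurd h (by positivity)
  rw [Finset.sum_eq_zero_iff_of_nonneg (fun i _ => mul_self_nonneg _)] at h
  refine AlternatingMap.coe_multilinearMap_injective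
    (Module.Basis.ext_multilinear (fun _ => gradedBasis ip) fun i => ?_)
  simpa using h i (Finset.mem_univ _)

theorem covectorForm_nondegenerate (k : ℕ) : (covectorForm ip k).Nondegenerate :=
  (LinearMap.IsRefl.nondegenerate_iff_separatingLeft (covectorForm_isSymm ip k).isRefl).2
    fun ξ h => eq_zero_of_covectorForm_self ip k ξ (h ξ)

theorem isCompl_orthogonal (k : ℕ) (W : Submodule ℝ (Covector L k)) :
    IsCompl W ((covectorForm ip k).orthogonal W) := by
  rw [LinearMap.BilinForm.isCompl_orthogonal_iff_disjoint (covectorForm_isSymm ip k).isRefl,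
    Submodule.disjoint_def]
  exact fun ξ h h' => eq_zero_of_covectorForm_self ip k ξ (h' ξ h)

/-- The adjoint `δ_0 : ⋀^{k+1} L^* → ⋀^k L^*` of `d_0 = ceDiff`, that is
`⟨d_0 ξ, η⟩_{k+1} = ⟨ξ, δ_0 η⟩_k`. -/
def ceAdjoint (k : ℕ) : Covector L (k + 1) →ₗ[ℝ] Covector L k :=
  ((covectorForm ip k).toDual (covectorForm_nondegenerate ip k)).symm.toLinearMap ∘ₗ
    (ceDiff k).dualMap ∘ₗ covectorForm ip (k + 1)

theorem covectorForm_ceDiff (k : ℕ) (ξ : Covector L k) (η : Covector L (k + 1)) :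
    covectorForm ip (k + 1) (ceDiff k ξ) η = covectorForm ip k ξ (ceAdjoint ip k η) := by
  rw [(covectorForm_isSymm ip k).eq, (covectorForm_isSymm ip (k + 1)).eq]
  simp [ceAdjoint, LinearMap.BilinForm.apply_toDual_symm_apply]

/-- The partial inverse `d_0⁻¹ : ⋀^{k+1} L^* → ⋀^k L^*`: orthogonal projection onto `Im d_0`,
followed by the inverse of the bijection `d_0 : (ker d_0)^⊥ → Im d_0`. -/
def cePartialInverse (k : ℕ) : Covector L (k + 1) →ₗ[ℝ] Covector L k :=
  ((covectorForm ip k).orthogonal (LinearMap.ker (ceDiff k))).subtype ∘ₗ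
    ((ceDiff k).kerComplementEquivRange
      (isCompl_orthogonal ip k (LinearMap.ker (ceDiff k))).symm).symm.toLinearMap ∘ₗ
    (LinearMap.range (ceDiff k)).projectionOnto _
      (isCompl_orthogonal ip (k + 1) (LinearMap.range (ceDiff k)))

end Algebra

/-! ### Smooth forms on a Lie group -/

instance : ENat.LEInfty (minSmoothness ℝ 3) :=
  ⟨by rw [minSmoothness_of_isRCLikeNormedField]; exact ENat.LEInfty.out⟩

section Group

variable (n : ℕ) (G : Type*) [TopologicalSpace G] [ChartedSpace (EuclideanSpace ℝ (Fin n)) G]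
  [Group G] [LieGroup (𝓡 n) ∞ G]

/-- The Lie algebra of `G`. -/
abbrev LieAlg : Type _ := GroupLieAlgebra (𝓡 n) G

instance : FiniteDimensional ℝ (LieAlg n G) :=
  inferInstanceAs (FiniteDimensional ℝ (EuclideanSpace ℝ (Fin n)))

/-- The smooth real functions on `G`. -/
abbrev SmoothFun : Type _ := C^∞⟮𝓡 n, G; 𝓘(ℝ, ℝ), ℝ⟯

/-- The smooth `k`-forms on `G`, `Ω^k(G) ≅ Hom(⋀^k 𝔤, C^∞(G))`: a form `α` is given by the smooth
functions `α(X_1, …, X_k)`, for `X_1, …, X_k` left-invariant vector fields. -/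
abbrev SmoothForm (k : ℕ) : Type _ := LieAlg n G [⋀^Fin k]→ₗ[ℝ] SmoothFun n G

variable {n G}

theorem contMDiff_invariantField (X : LieAlg n G) :
    ContMDiff (𝓡 n) (𝓡 n).tangent ∞
      (fun x : G => (mulInvariantVectorField X x : TangentBundle (𝓡 n) G)) := by
  let F₁ : G → TangentBundle (𝓡 n) G × TangentBundle (𝓡 n) G := fun x =>
    (Bundle.TotalSpace.mk' (EuclideanSpace ℝ (Fin n)) x 0,
      Bundle.TotalSpace.mk' (EuclideanSpace ℝ (Fin n)) (1 : G) X)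
  have S₁ : ContMDiff (𝓡 n) ((𝓡 n).tangent.prod (𝓡 n).tangent) ∞ F₁ :=
    (Bundle.contMDiff_zeroSection _ _).prodMk contMDiff_const
  let F₂ : TangentBundle (𝓡 n) G × TangentBundle (𝓡 n) G →
      TangentBundle ((𝓡 n).prod (𝓡 n)) (G × G) := (equivTangentBundleProd (𝓡 n) G (𝓡 n) G).symm
  have S₂ : ContMDiff ((𝓡 n).tangent.prod (𝓡 n).tangent) ((𝓡 n).prod (𝓡 n)).tangent ∞ F₂ :=
    contMDiff_equivTangentBundleProd_symm
  let F₃ := tangentMap ((𝓡 n).prod (𝓡 n)) (𝓡 n) (fun p : G × G => p.1 * p.2)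
  have S₃ : ContMDiff ((𝓡 n).prod (𝓡 n)).tangent (𝓡 n).tangent ∞ F₃ :=
    ContMDiff.contMDiff_tangentMap (n := ∞) (contMDiff_mul (𝓡 n) ∞) le_rfl
  have S := (S₃.comp S₂).comp S₁
  convert! S with x
  · simp [F₁, F₂, F₃]
  · simp only [Function.comp_apply, tangentMap, F₃, F₂, F₁]
    rw [mfderiv_prod_eq_add_apply ((contMDiff_mul (𝓡 n) ∞).mdifferentiableAt (by simp))]
    change mfderiv (𝓡 n) (𝓡 n) (fun y : G => x * y) 1 X =
      mfderiv (𝓡 n) (𝓡 n) (fun z : G => z * 1) x 0 + mfderiv (𝓡 n) (𝓡 n) (fun y : G => x * y) 1 X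
    rw [(mfderiv (𝓡 n) (𝓡 n) (fun z : G => z * 1) x).map_zero]
    exact (zero_add (mfderiv (𝓡 n) (𝓡 n) (fun y : G => x * y) 1 X :
      EuclideanSpace ℝ (Fin n))).symm

theorem contMDiff_invariantDeriv (X : LieAlg n G) (f : SmoothFun n G) :
    ContMDiff (𝓡 n) 𝓘(ℝ, ℝ) ∞
      (fun x => (mfderiv (𝓡 n) 𝓘(ℝ, ℝ) f x (mulInvariantVectorField X x) : ℝ)) :=
  (contMDiff_snd_tangentBundle_modelSpace ℝ 𝓘(ℝ, ℝ)).comp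
    ((ContMDiff.contMDiff_tangentMap (n := ∞) f.contMDiff le_rfl).comp (contMDiff_invariantField X))

/-- The action `f ↦ X f` of the left-invariant vector field `X` on smooth functions, linear in
`X`. -/
def invariantDeriv : LieAlg n G →ₗ[ℝ] SmoothFun n G →ₗ[ℝ] SmoothFun n G :=
  LinearMap.mk₂ ℝ
    (fun X f => ⟨fun x => (mfderiv (𝓡 n) 𝓘(ℝ, ℝ) f x (mulInvariantVectorField X x) : ℝ),
      contMDiff_invariantDeriv X f⟩)
    (fun X Y f => by
      ext x
      change mfderiv (𝓡 n) 𝓘(ℝ, ℝ) f x (mulInvariantVectorField (X + Y) x) = _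
      rw [mulInvariantVectorField_add]
      exact map_add _ _ _)
    (fun c X f => by
      ext x
      change mfderiv (𝓡 n) 𝓘(ℝ, ℝ) f x (mulInvariantVectorField (c • X) x) = _
      rw [mulInvariantVectorField_smul]
      exact (mfderiv (𝓡 n) 𝓘(ℝ, ℝ) f x).map_smul _ _)
    (fun X f g => by
      ext x
      have hf : MDifferentiableAt (𝓡 n) 𝓘(ℝ, ℝ) f x :=
        f.contMDiff.mdifferentiableAt (by simp)
      have hg : MDifferentiableAt (𝓡 n) 𝓘(ℝ, ℝ) g x :=
        g.contMDiff.mdifferentiableAt (by simp)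
      change mfderiv (𝓡 n) 𝓘(ℝ, ℝ) (⇑f + ⇑g) x (mulInvariantVectorField X x) = _
      rw [mfderiv_add hf hg]
      rfl)
    (fun c X f => by
      ext x
      have hf : MDifferentiableAt (𝓡 n) 𝓘(ℝ, ℝ) f x :=
        f.contMDiff.mdifferentiableAt (by simp)
      change mfderiv (𝓡 n) 𝓘(ℝ, ℝ) (c • ⇑f) x (mulInvariantVectorField X x) = _
      rw [const_smul_mfderiv hf]
      rfl)

/-- The value at `x` of a smooth form, as a left-invariant form. -/
def evalAt {k : ℕ} (x : G) : SmoothForm n G k →ₗ[ℝ] Covector (LieAlg n G) k :=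
  { toFun := fun α => (LinearMap.proj x ∘ₗ ContMDiffMap.coeFnLinearMap).compAlternatingMap α
    map_add' := fun _ _ => rfl
    map_smul' := fun _ _ => rfl }

theorem evalAt_apply {k : ℕ} (x : G) (α : SmoothForm n G k) (v : Fin k → LieAlg n G) :
    evalAt x α v = α v x := rfl

theorem contMDiff_comp_evalAt {k : ℕ} (φ : Covector (LieAlg n G) k →ₗ[ℝ] ℝ)
    (α : SmoothForm n G k) : ContMDiff (𝓡 n) 𝓘(ℝ, ℝ) ∞ (fun x => φ (evalAt x α)) := by
  let b := Module.finBasis ℝ (LieAlg n G)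
  let ev : Covector (LieAlg n G) k →ₗ[ℝ] (Fin k → Fin (Module.finrank ℝ (LieAlg n G))) → ℝ :=
    { toFun := fun ξ i => ξ (fun a => b (i a))
      map_add' := fun _ _ => rfl
      map_smul' := fun _ _ => rfl }
  have hev : LinearMap.ker ev = ⊥ := by
    refine LinearMap.ker_eq_bot'.2 fun ξ h => ?_
    refine AlternatingMap.coe_multilinearMap_injective
      (Module.Basis.ext_multilinear (fun _ => b) fun i => ?_)
    exact congrFun h i
  obtain ⟨g, hg⟩ := ev.exists_leftInverse_of_injective hev
  have key : ∀ ξ, φ ξ = ∑ i, φ (g (Pi.single i 1)) * ξ (fun a => b (i a)) := fun ξ => by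
    have h1 : φ ξ = φ (g (ev ξ)) := by
      rw [← LinearMap.comp_apply g ev, hg, LinearMap.id_apply]
    rw [h1, ← Finset.univ_sum_single (ev ξ), map_sum, map_sum]
    refine Finset.sum_congr rfl fun i _ => ?_
    have h2 : (Pi.single i (ev ξ i) : (Fin k → Fin (Module.finrank ℝ (LieAlg n G))) → ℝ)
        = ev ξ i • Pi.single i 1 := by
      rw [← Pi.single_smul, smul_eq_mul, mul_one]
    rw [h2, map_smul, map_smul, smul_eq_mul, mul_comm]
    rfl
  have h3 : (fun x => φ (evalAt x α)) =
      fun x => ∑ i, φ (g (Pi.single i 1)) * α (fun a => b (i a)) x :=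
    funext fun x => key (evalAt x α)
  rw [h3]
  exact contMDiff_finsetSum fun i _ => contMDiff_const.mul (α _).contMDiff

/-- The `C^∞(G)`-linear extension to smooth forms of a linear map `T` between spaces of
left-invariant forms: `(T α)_x = T (α_x)`. -/
def extendPointwise {k l : ℕ}
    (T : Covector (LieAlg n G) k →ₗ[ℝ] Covector (LieAlg n G) l) :
    SmoothForm n G k →ₗ[ℝ] SmoothForm n G l where
  toFun α :=
    { toFun := fun v => ⟨fun x => T (evalAt x α) v,
        contMDiff_comp_evalAt
          { toFun := fun ξ => T ξ v
            map_add' := fun ξ η => by rw [map_add]; rfl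
            map_smul' := fun c ξ => by rw [map_smul]; rfl } α⟩
      map_update_add' := fun v i y z => by
        ext x; exact (T (evalAt x α)).map_update_add v i y z
      map_update_smul' := fun v i c y => by
        ext x; exact (T (evalAt x α)).map_update_smul v i c y
      map_eq_zero_of_eq' := fun v i j h hij => by
        ext x; exact (T (evalAt x α)).map_eq_zero_of_eq v h hij }
  map_add' α β := by
    ext v x
    change T (evalAt x (α + β)) v = T (evalAt x α) v + T (evalAt x β) v
    rw [map_add, map_add]; rfl
  map_smul' c α := by
    ext v x
    change T (evalAt x (c • α)) v = c • T (evalAt x α) v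
    rw [map_smul, map_smul]; rfl

theorem extendPointwise_apply {k l : ℕ}
    (T : Covector (LieAlg n G) k →ₗ[ℝ] Covector (LieAlg n G) l) (α : SmoothForm n G k)
    (v : Fin l → LieAlg n G) (x : G) : extendPointwise T α v x = T (evalAt x α) v := rfl

/-- For a linear endomorphism `p` of the Lie algebra, the operator
`α ↦ ∑_i (-1)^i (p X_i)(α(X_0, …, X̂_i, …, X_k))`; for `p = id` and `α = f ξ` with `ξ` left-invariant
this is `df ∧ ξ`, and for `p` the projection onto a layer only the derivatives along that layer
are kept. -/
def derivWedge (p : LieAlg n G →ₗ[ℝ] LieAlg n G) (k : ℕ) :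
    SmoothForm n G k →ₗ[ℝ] SmoothForm n G (k + 1) where
  toFun α := AlternatingMap.alternatizeUncurryFin
    { toFun := fun X => (invariantDeriv (p X)).compAlternatingMap α
      map_add' := fun X Y => by rw [map_add, map_add]; rfl
      map_smul' := fun c X => by rw [map_smul, map_smul]; rfl }
  map_add' α β := by
    rw [← AlternatingMap.alternatizeUncurryFin_add]
    congr 1
    ext X v x
    simp
  map_smul' c α := by
    rw [← AlternatingMap.alternatizeUncurryFin_smul]
    congr 1
    ext X v x
    simp

theorem derivWedge_apply (p : LieAlg n G →ₗ[ℝ] LieAlg n G) (k : ℕ) (α : SmoothForm n G k)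
    (X : Fin (k + 1) → LieAlg n G) :
    derivWedge p k α X =
      ∑ i : Fin (k + 1), (-1) ^ (i : ℕ) • invariantDeriv (p (X i)) (α (i.removeNth X)) :=
  AlternatingMap.alternatizeUncurryFin_apply _ _

/-! ### Operators on the space of all forms -/

variable (n G) in
/-- The space `Ω^•(G)` of forms of all degrees (all but finitely many components vanish
automatically). -/
abbrev Form : Type _ := (k : ℕ) → SmoothForm n G k

variable (n G) in
/-- The subspace `Ω^k(G)` of `Ω^•(G)`. -/
def formsOfDegree (k : ℕ) : Submodule ℝ (Form n G) :=
  LinearMap.range (LinearMap.single ℝ (fun k => SmoothForm n G k) k)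

/-- The operator on `Ω^•(G)` with components `Ω^k(G) → Ω^{k+1}(G)`. -/
def raising (T : (k : ℕ) → SmoothForm n G k →ₗ[ℝ] SmoothForm n G (k + 1)) :
    Module.End ℝ (Form n G) :=
  LinearMap.pi fun k => match k with
    | 0 => 0
    | k + 1 => T k ∘ₗ LinearMap.proj k

/-- The operator on `Ω^•(G)` with components `Ω^{k+1}(G) → Ω^k(G)`, zero on `Ω^0(G)`. -/
def lowering (T : (k : ℕ) → SmoothForm n G (k + 1) →ₗ[ℝ] SmoothForm n G k) :
    Module.End ℝ (Form n G) :=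
  LinearMap.pi fun k => T k ∘ₗ LinearMap.proj (k + 1)

variable (n G) in
/-- The algebraic part `d_0` of the exterior derivative: the `C^∞(G)`-linear operator with
`d_0 (f ξ) = f dξ` for `ξ` left-invariant. -/
def d0 : Module.End ℝ (Form n G) := raising fun k => extendPointwise (ceDiff k)

variable (n G) in
/-- The exterior derivative
`dα (X_0, …, X_k) = ∑_i (-1)^i X_i (α(X_0, …, X̂_i, …, X_k))
  + ∑_{i<j} (-1)^{i+j} α([X_i, X_j], X_0, …, X̂_i, …, X̂_j, …, X_k)`
(the `X_i` being left-invariant vector fields), so that `d (f ξ) = df ∧ ξ + f dξ`. -/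
def extDer : Module.End ℝ (Form n G) :=
  (raising fun k => derivWedge LinearMap.id k) + d0 n G

section Rumin

variable (gr : PositiveGrading (LieAlg n G))

/-- The components `d_0, d_1, d_2, …` of `d`, where `d_w` raises the weight of forms by `w`: for
`w ≥ 1`, `d_w (f ξ) = ∑_{X_l ∈ 𝔤_w} X_l f θ_l ∧ ξ` for `ξ` left-invariant. -/
def dWeight : ℕ → Module.End ℝ (Form n G)
  | 0 => d0 n G
  | w + 1 => raising fun k => derivWedge (gr.proj (w + 1)) k

variable {gr} (ip : AdaptedScalarProduct gr)

/-- The adjoint `δ_0` of `d_0`. -/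
def delta0 : Module.End ℝ (Form n G) := lowering fun k => extendPointwise (ceAdjoint ip k)

/-- The partial inverse `d_0⁻¹` of `d_0`. -/
def d0inv : Module.End ℝ (Form n G) := lowering fun k => extendPointwise (cePartialInverse ip k)

/-- The Rumin forms `E_0^k = ker d_0 ∩ ker δ_0 ∩ Ω^k(G) = ker (d_0 δ_0 + δ_0 d_0) ∩ Ω^k(G)`. -/
def RuminForms (k : ℕ) : Submodule ℝ (Form n G) :=
  LinearMap.ker (d0 n G) ⊓ LinearMap.ker (delta0 ip) ⊓ formsOfDegree n G k

/-- `Π_0 = Id - d_0 d_0⁻¹ - d_0⁻¹ d_0`, the orthogonal projection onto `E_0`. -/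
def projE0 : Module.End ℝ (Form n G) := 1 - d0 n G * d0inv ip - d0inv ip * d0 n G

/-- `b = d_0⁻¹ d_0 - d_0⁻¹ d`. -/
def bOp : Module.End ℝ (Form n G) := d0inv ip * d0 n G - d0inv ip * extDer n G

/-- `Π = (Id - b)⁻¹ d_0⁻¹ d + d (Id - b)⁻¹ d_0⁻¹`. -/
def projF : Module.End ℝ (Form n G) :=
  Ring.inverse (1 - bOp ip) * d0inv ip * extDer n G +
    extDer n G * Ring.inverse (1 - bOp ip) * d0inv ip

/-- `Π_E = Id - Π`. -/
def projE : Module.End ℝ (Form n G) := 1 - projF ip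

/-- The Rumin differential `d_c = Π_0 d Π_E` (to be applied to Rumin forms). -/
def ruminDiff : Module.End ℝ (Form n G) := projE0 ip * extDer n G * projE ip

/-- The operators `∂_r = d_r - ∑_{1 ≤ j < r} d_{r-j} d_0⁻¹ ∂_j`, for `r ≥ 1`. -/
def partialOp (r : ℕ) : Module.End ℝ (Form n G) :=
  dWeight gr r - ∑ j ∈ (Finset.Ico 1 r).attach,
    dWeight gr (r - j) * d0inv ip * partialOp j
termination_by r
decreasing_by exact (Finset.mem_Ico.1 j.2).2

theorem partialOp_eq (r : ℕ) : partialOp ip r =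
    dWeight gr r - ∑ j ∈ Finset.Ico 1 r, dWeight gr (r - j) * d0inv ip * partialOp ip j := by
  rw [partialOp, Finset.sum_attach (Finset.Ico 1 r)
    (fun j => dWeight gr (r - j) * d0inv ip * partialOp ip j)]

/-- The operator `d_0⁻¹ (d - d_0)`. -/
def stepOp : Module.End ℝ (Form n G) := d0inv ip * (extDer n G - d0 n G)

/-- The sum `∂_1 + ⋯ + ∂_N`. -/
def partialSum (N : ℕ) : Module.End ℝ (Form n G) := ∑ i ∈ Finset.Icc 1 N, partialOp ip i

/-- The recursive use of the Leibniz rule. A state is a triple `(η, ζ, ρ)`, standing for the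
expression `dη + ζ + ρ`, in which `ρ` has still to be processed. One step splits
`ρ = d_0 d_0⁻¹ ρ + Π_0 ρ + d_0⁻¹ d_0 ρ`, collects the last two summands in `ζ` and rewrites the
first one by the Leibniz rule `d_0 β = dβ - (d - d_0) β` with `β = d_0⁻¹ ρ`. -/
def leibnizStep (s : Form n G × Form n G × Form n G) : Form n G × Form n G × Form n G :=
  (s.1 + d0inv ip s.2.2,
    s.2.1 + projE0 ip s.2.2 + d0inv ip (d0 n G s.2.2),
    -(extDer n G - d0 n G) (d0inv ip s.2.2))

/-- The expression reached from `dα` after `m` steps of the recursion. -/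
def leibnizRec (α : Form n G) (m : ℕ) : Form n G × Form n G × Form n G :=
  (leibnizStep ip)^[m] (0, 0, extDer n G α)

end Rumin

end Group

end RuminLeibniz

end

open RuminLeibniz

/-! Put `D = d - d_0`, so that `P = d_0⁻¹ D` and `1 - b = 1 + P`. On a Rumin form `α` one has `dα =
Dα`, and one step of the recursion replaces `ρ` by `-D d_0⁻¹ ρ`. Hence `ρ_m = D (-P)^m α`
(`leibnizRec_rho`), and `η` and `ζ` accumulate partial sums of the Neumann series `S = ∑_{i ≤ N}
(-P)^i α`: `η_{N+1} = P S` and `ζ_{N+1} = (Π_0 + d_0⁻¹ d_0) D S`. If `P^{N+1} α = 0`, then `S + P S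
= α`. Together with `d_0⁻¹ α = 0` this gives `Π_E α = S` (`projE_apply_of_mem_RuminForms`), and `Π_0
d_0 = 0` gives `d_c α = Π_0 D S`.

The link with the `∂_r` is a fixed-point equation. Applying `D` to `S + P S = α` shows that `u = D
S` solves `u + D d_0⁻¹ u = D α`. Summing the recursion for `∂_r` shows that `∑ ∂_r α` solves the
same equation, and the solution is unique (`extDer_sub_d0_neumannSum`).

Termination and uniqueness come from the filtration by weight: `D` raises weights by at least one
because the grading is positive, `d_0⁻¹` does not lower them, and the weights of forms are bounded.
The claim on `d_0⁻¹` (`cePartialInverse_weight`) holds because `d_0⁻¹` commutes with a dilation that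
is diagonal in the graded basis.

Finally, `Π_0` takes values in `ker d_0 ∩ ker δ_0` because `d_0² = 0` (`ceDiff_ceDiff`) and because
`d_0⁻¹` and `δ_0` have the same kernel; the values of `d_0⁻¹` lie in `Im δ_0` by orthogonality. -/

noncomputable section

namespace RuminLeibniz

/-! ### Cartan calculus on left-invariant forms, and `d_0² = 0`. -/

section Cartan

variable {V : Type*} [AddCommGroup V] [Module ℝ V]

theorem alternatizeUncurryFin_neg {k : ℕ} (f : V →ₗ[ℝ] V [⋀^Fin k]→ₗ[ℝ] ℝ) :
    AlternatingMap.alternatizeUncurryFin (-f) = -AlternatingMap.alternatizeUncurryFin f := by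
  ext v
  simp [AlternatingMap.alternatizeUncurryFin_apply]

/-- Antiderivation rule. In the alternating sum `x` either is the argument of `f`, or stays in first
place inside the form; in the second case the removed position shifts by one, whence the minus sign.
-/
theorem curryLeft_alternatizeUncurryFin {k : ℕ} (f : V →ₗ[ℝ] V [⋀^Fin (k + 1)]→ₗ[ℝ] ℝ) (x : V) :
    (AlternatingMap.alternatizeUncurryFin f).curryLeft x =
      f x - AlternatingMap.alternatizeUncurryFin
        (AlternatingMap.curryLeftLinearMap.flip x ∘ₗ f) := by
  ext v
  rw [AlternatingMap.curryLeft_apply_apply, AlternatingMap.alternatizeUncurryFin_apply,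
    Fin.sum_univ_succ, AlternatingMap.sub_apply, AlternatingMap.alternatizeUncurryFin_apply,
    sub_eq_add_neg, ← Finset.sum_neg_distrib]
  congr 1
  · simp [Matrix.vecCons]
  · refine Finset.sum_congr rfl fun i _ => ?_
    have h : i.succ.removeNth (Matrix.vecCons x v) = Matrix.vecCons x (i.removeNth v) := by
      ext j
      refine Fin.cases ?_ (fun j => ?_) j <;> simp [Fin.removeNth]
    rw [h]
    simp [pow_succ]

theorem curryLeft_alternatizeUncurryFin_zero (f : V →ₗ[ℝ] V [⋀^Fin 0]→ₗ[ℝ] ℝ) (x : V) :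
    (AlternatingMap.alternatizeUncurryFin f).curryLeft x = f x := by
  ext v
  rw [AlternatingMap.curryLeft_apply_apply, AlternatingMap.alternatizeUncurryFin_apply]
  simp only [Nat.reduceAdd, Finset.univ_unique, Finset.sum_singleton]
  simp [Matrix.vecCons, Subsingleton.elim _ v]

variable {L : Type*} [LieRing L] [LieAlgebra ℝ L]

/-- The interior product `ι_X`. -/
def interior {k : ℕ} (X : L) : Covector L (k + 1) →ₗ[ℝ] Covector L k :=
  AlternatingMap.curryLeftLinearMap.flip X

theorem interior_apply {k : ℕ} (X : L) (ξ : Covector L (k + 1)) :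
    interior X ξ = ξ.curryLeft X := rfl

theorem interior_interior {k : ℕ} (X Y : L) (ξ : Covector L (k + 2)) :
    interior X (interior Y ξ) = -interior Y (interior X ξ) := by
  have h := AlternatingMap.curryLeft_same ξ (X + Y)
  have h1 := AlternatingMap.curryLeft_same ξ X
  have h2 := AlternatingMap.curryLeft_same ξ Y
  simp only [map_add, AlternatingMap.curryLeft_add, LinearMap.add_apply] at h
  simp only [interior_apply]
  rw [eq_neg_iff_add_eq_zero]
  simpa [h1, h2] using h

theorem covector_ext {k : ℕ} {ξ η : Covector L (k + 1)}
    (h : ∀ X, interior X ξ = interior X η) : ξ = η := by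
  ext v
  have := DFunLike.congr_fun (h (v 0)) (fun i => v i.succ)
  simp only [interior_apply, AlternatingMap.curryLeft_apply_apply] at this
  rwa [show Matrix.vecCons (v 0) (fun i => v i.succ) = v from Fin.cons_self_tail v] at this

theorem bracketContraction_apply {k : ℕ} (ξ : Covector L (k + 1)) (X Y : L) :
    bracketContraction ξ X Y = interior ⁅X, Y⁆ ξ := rfl

theorem interior_add_left {k : ℕ} (X Y : L) (ξ : Covector L (k + 1)) :
    interior (X + Y) ξ = interior X ξ + interior Y ξ := map_add ξ.curryLeft X Y

theorem interior_neg_left {k : ℕ} (X : L) (ξ : Covector L (k + 1)) :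
    interior (-X) ξ = -interior X ξ := map_neg ξ.curryLeft X

theorem interior_comp_bracketContraction {k : ℕ} (ξ : Covector L (k + 2)) (X Y : L) :
    AlternatingMap.curryLeftLinearMap.flip X ∘ₗ bracketContraction ξ Y =
      -bracketContraction (interior X ξ) Y :=
  LinearMap.ext fun Z => interior_interior X ⁅Y, Z⁆ ξ

/-- The Lie derivative on covectors, `-∑ ι_{[X, ·]}` alternatized. -/
def lieDeriv (X : L) : (k : ℕ) → Covector L k →ₗ[ℝ] Covector L k
  | 0 => 0
  | k + 1 => interior X ∘ₗ ceDiff (k + 1) + ceDiff k ∘ₗ interior X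

theorem interior_ceDiff {k : ℕ} (X : L) (ξ : Covector L (k + 1)) :
    interior X (ceDiff (k + 1) ξ) =
      lieDeriv X (k + 1) ξ - ceDiff k (interior X ξ) :=
  eq_sub_of_add_eq rfl

theorem ceDiff_succ {k : ℕ} (ξ : Covector L (k + 1)) :
    ceDiff (k + 1) ξ = -(1 / 2 : ℝ) • AlternatingMap.alternatizeUncurryFin
        (AlternatingMap.alternatizeUncurryFinLM ∘ₗ bracketContraction ξ) := rfl

theorem bracketContraction_flip {k : ℕ} (ξ : Covector L (k + 1)) (X : L) :
    (bracketContraction ξ).flip X = -bracketContraction ξ X := by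
  ext Y : 1
  change interior ⁅Y, X⁆ ξ = -interior ⁅X, Y⁆ ξ
  rw [← lie_skew, interior_neg_left]

/-- Cartan's formula. Contracting the double alternatization in `ceDiff` with `X` yields the
right-hand side twice, once from each slot of the bracket, which absorbs the factor `1/2`; what
remains is `-d(ι_X ξ)`, cancelled by the second term of the Lie derivative. -/
theorem lieDeriv_succ {k : ℕ} (X : L) (ξ : Covector L (k + 1)) :
    lieDeriv X (k + 1) ξ = -AlternatingMap.alternatizeUncurryFin (bracketContraction ξ X) := by
  have key : ∀ (f : L →ₗ[ℝ] Covector L k) (c : Covector L (k + 1)),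
      c = -(1 / 2 : ℝ) • (AlternatingMap.alternatizeUncurryFin f +
        AlternatingMap.alternatizeUncurryFin f) →
        c = -AlternatingMap.alternatizeUncurryFin f := by
    rintro f c rfl
    module
  cases k with
  | zero =>
    apply key
    -- The `0` is `d_0 (ι_X ξ)`, since `d_0` vanishes on constants.
    change interior X (ceDiff 1 ξ) + 0 = _
    rw [add_zero, ceDiff_succ, map_smul, interior_apply, curryLeft_alternatizeUncurryFin,
      sub_eq_add_neg]
    congr 2
    have : AlternatingMap.curryLeftLinearMap.flip X ∘ₗ
        AlternatingMap.alternatizeUncurryFinLM ∘ₗ bracketContraction ξ =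
          -bracketContraction ξ X := by
      rw [← bracketContraction_flip]
      ext Y : 1
      exact curryLeft_alternatizeUncurryFin_zero (bracketContraction ξ Y) X
    rw [this, alternatizeUncurryFin_neg, neg_neg]
  | succ k =>
    have h1 : AlternatingMap.curryLeftLinearMap.flip X ∘ₗ
        AlternatingMap.alternatizeUncurryFinLM ∘ₗ bracketContraction ξ =
          -bracketContraction ξ X +
            AlternatingMap.alternatizeUncurryFinLM ∘ₗ bracketContraction (interior X ξ) := by
      rw [← bracketContraction_flip]
      ext Y : 1
      refine (curryLeft_alternatizeUncurryFin (bracketContraction ξ Y) X).trans ?_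
      rw [interior_comp_bracketContraction, alternatizeUncurryFin_neg, sub_neg_eq_add]
      rfl
    change interior X (ceDiff (k + 2) ξ) + ceDiff (k + 1) (interior X ξ) = _
    rw [ceDiff_succ, map_smul, interior_apply, curryLeft_alternatizeUncurryFin, h1, ceDiff_succ,
      AlternatingMap.alternatizeUncurryFin_add]
    rw [alternatizeUncurryFin_neg, LinearMap.comp_apply,
      AlternatingMap.alternatizeUncurryFinLM_apply]
    generalize AlternatingMap.alternatizeUncurryFin (AlternatingMap.alternatizeUncurryFinLM ∘ₗ
      bracketContraction (interior X ξ)) = a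
    generalize AlternatingMap.alternatizeUncurryFin (bracketContraction ξ X) = b
    module

theorem interior_lieDeriv {k : ℕ} (X Y : L) (ξ : Covector L (k + 1)) :
    interior Y (lieDeriv X (k + 1) ξ) = lieDeriv X k (interior Y ξ) - interior ⁅X, Y⁆ ξ := by
  rw [lieDeriv_succ, map_neg, interior_apply]
  cases k with
  | zero =>
    rw [curryLeft_alternatizeUncurryFin_zero, bracketContraction_apply]
    exact (zero_sub _).symm
  | succ k =>
    rw [curryLeft_alternatizeUncurryFin, interior_comp_bracketContraction, lieDeriv_succ,
      bracketContraction_apply, alternatizeUncurryFin_neg]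
    abel

/-- The Jacobi identity enters here. Contracting with `Z` reduces the degree, and the leftover terms
are its three double brackets. -/
theorem lieDeriv_lie (X Y : L) : ∀ (k : ℕ) (ξ : Covector L k),
    lieDeriv X k (lieDeriv Y k ξ) - lieDeriv Y k (lieDeriv X k ξ) = lieDeriv ⁅X, Y⁆ k ξ
  | 0, ξ => sub_self _
  | k + 1, ξ => by
    refine covector_ext fun Z => ?_
    have hJ : ⁅⁅X, Y⁆, Z⁆ = ⁅X, ⁅Y, Z⁆⁆ + -⁅Y, ⁅X, Z⁆⁆ := by
      rw [lie_lie, sub_eq_add_neg]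
    simp only [map_sub, interior_lieDeriv, ← lieDeriv_lie X Y k (interior Z ξ), hJ,
      interior_add_left, interior_neg_left]
    abel

theorem lieDeriv_ceDiff (X : L) : ∀ (k : ℕ) (ξ : Covector L k),
    lieDeriv X (k + 1) (ceDiff k ξ) = ceDiff k (lieDeriv X k ξ)
  | 0, ξ => map_zero _
  | k + 1, ξ => by
    refine covector_ext fun Y => ?_
    have h := lieDeriv_lie X Y (k + 1) ξ
    rw [interior_lieDeriv, interior_ceDiff, interior_ceDiff, map_sub,
      lieDeriv_ceDiff X k, interior_ceDiff, interior_lieDeriv, map_sub, ← h]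
    abel

/-- Induction on the degree: `ι_X d d = L_X d - d L_X + d d ι_X`, and `L_X` commutes with `d`. -/
theorem ceDiff_ceDiff : ∀ (k : ℕ) (ξ : Covector L k), ceDiff (k + 1) (ceDiff k ξ) = 0
  | 0, ξ => map_zero _
  | k + 1, ξ => by
    refine covector_ext fun X => ?_
    rw [interior_ceDiff, interior_ceDiff, lieDeriv_ceDiff, map_sub, ceDiff_ceDiff k, map_zero]
    abel

end Cartan

/-! ### The partial inverse of `d_0` on left-invariant forms. -/

section PartialInverse

variable {L : Type*} [LieRing L] [LieAlgebra ℝ L] [FiniteDimensional ℝ L]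
  {gr : PositiveGrading L} (ip : AdaptedScalarProduct gr)

theorem cePartialInverse_ceDiff {k : ℕ} {ξ : Covector L k}
    (hξ : ξ ∈ (covectorForm ip k).orthogonal (LinearMap.ker (ceDiff k))) :
    cePartialInverse ip k (ceDiff k ξ) = ξ := by
  simp only [cePartialInverse, LinearMap.comp_apply]
  rw [Submodule.projectionOnto_apply_of_mem_left _ (LinearMap.mem_range_self _ ξ)]
  have h : (ceDiff k).kerComplementEquivRange
      (isCompl_orthogonal ip k (LinearMap.ker (ceDiff k))).symm ⟨ξ, hξ⟩ =
        ⟨ceDiff k ξ, LinearMap.mem_range_self _ ξ⟩ := rfl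
  rw [← h]
  simp only [LinearEquiv.coe_coe, LinearEquiv.symm_apply_apply, Submodule.subtype_apply]

theorem cePartialInverse_mem {k : ℕ} (η : Covector L (k + 1)) :
    cePartialInverse ip k η ∈ (covectorForm ip k).orthogonal (LinearMap.ker (ceDiff k)) :=
  Subtype.coe_prop _

theorem cePartialInverse_eq_zero_iff {k : ℕ} {η : Covector L (k + 1)} :
    cePartialInverse ip k η = 0 ↔
      η ∈ (covectorForm ip (k + 1)).orthogonal (LinearMap.range (ceDiff k)) := by
  simp only [cePartialInverse, LinearMap.comp_apply, Submodule.subtype_apply,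
    LinearEquiv.coe_coe, ZeroMemClass.coe_eq_zero, EmbeddingLike.map_eq_zero_iff,
    Submodule.projectionOnto_apply_eq_zero_iff]

/-- Both kernels are `(Im d_0)^⊥`. -/
theorem cePartialInverse_eq_zero_iff_ceAdjoint {k : ℕ} {η : Covector L (k + 1)} :
    cePartialInverse ip k η = 0 ↔ ceAdjoint ip k η = 0 := by
  rw [cePartialInverse_eq_zero_iff]
  constructor
  · intro h
    refine eq_zero_of_covectorForm_self ip k _ ?_
    rw [← covectorForm_ceDiff]
    exact h _ (LinearMap.mem_range_self _ _)
  · rintro h _ ⟨ξ, rfl⟩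
    change covectorForm ip (k + 1) (ceDiff k ξ) η = 0
    rw [covectorForm_ceDiff, h, map_zero]

/-- Every left-invariant form decomposes as `d_0 ξ + η'` with `ξ ⟂ ker d_0` and `η' ⟂ Im d_0`. -/
theorem exists_ceDiff_add {k : ℕ} (η : Covector L (k + 1)) :
    ∃ ξ ∈ (covectorForm ip k).orthogonal (LinearMap.ker (ceDiff k)),
      ∃ η' ∈ (covectorForm ip (k + 1)).orthogonal (LinearMap.range (ceDiff k)),
        ceDiff k ξ + η' = η := by
  obtain ⟨_, η', ⟨ξ, rfl⟩, hη', h⟩ := Submodule.codisjoint_iff_exists_add_eq.1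
    (isCompl_orthogonal ip (k + 1) (LinearMap.range (ceDiff k))).codisjoint η
  obtain ⟨κ, ξ', hκ, hξ', rfl⟩ := Submodule.codisjoint_iff_exists_add_eq.1
    (isCompl_orthogonal ip k (LinearMap.ker (ceDiff k))).codisjoint ξ
  refine ⟨ξ', hξ', η', hη', ?_⟩
  rw [← h, map_add, LinearMap.mem_ker.1 hκ, zero_add]

theorem ceDiff_cePartialInverse_ceDiff {k : ℕ} (ξ : Covector L k) :
    ceDiff k (cePartialInverse ip k (ceDiff k ξ)) = ceDiff k ξ := by
  obtain ⟨κ, ξ', hκ, hξ', rfl⟩ := Submodule.codisjoint_iff_exists_add_eq.1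
    (isCompl_orthogonal ip k (LinearMap.ker (ceDiff k))).codisjoint ξ
  rw [map_add, LinearMap.mem_ker.1 hκ, zero_add, cePartialInverse_ceDiff ip hξ']

theorem cePartialInverse_ceDiff_cePartialInverse {k : ℕ} (η : Covector L (k + 1)) :
    cePartialInverse ip k (ceDiff k (cePartialInverse ip k η)) = cePartialInverse ip k η :=
  cePartialInverse_ceDiff ip (cePartialInverse_mem ip η)

/-- A value of `d_0⁻¹` is orthogonal to `ker d_0`, hence to `Im d_0` because `d_0² = 0`. -/
theorem cePartialInverse_cePartialInverse {k : ℕ} (η : Covector L (k + 2)) :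
    cePartialInverse ip k (cePartialInverse ip (k + 1) η) = 0 := by
  rw [cePartialInverse_eq_zero_iff]
  rintro _ ⟨ξ, rfl⟩
  exact cePartialInverse_mem ip η _ (ceDiff_ceDiff k ξ)

/-- The component of `d_0⁻¹ η` orthogonal to `Im δ_0` lies in `ker d_0`. It is thus orthogonal to
`d_0⁻¹ η` and to `Im δ_0`, hence to itself. -/
theorem range_cePartialInverse_le (k : ℕ) :
    LinearMap.range (cePartialInverse ip k) ≤ LinearMap.range (ceAdjoint ip k) := by
  rintro _ ⟨η, rfl⟩
  obtain ⟨_, ξ', ⟨ζ, rfl⟩, hξ', h⟩ := Submodule.codisjoint_iff_exists_add_eq.1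
    (isCompl_orthogonal ip k (LinearMap.range (ceAdjoint ip k))).codisjoint
    (cePartialInverse ip k η)
  have hker : ceDiff k ξ' = 0 := by
    refine eq_zero_of_covectorForm_self ip (k + 1) _ ?_
    rw [covectorForm_ceDiff, (covectorForm_isSymm ip k).eq]
    exact hξ' _ (LinearMap.mem_range_self _ _)
  have h1 : covectorForm ip k ξ' (cePartialInverse ip k η) = 0 := cePartialInverse_mem ip η _ hker
  have h2 : covectorForm ip k ξ' (ceAdjoint ip k ζ) = 0 := by
    rw [← covectorForm_ceDiff, hker, map_zero, LinearMap.zero_apply]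
  rw [← h, map_add, h2, zero_add] at h1
  rw [← h, eq_zero_of_covectorForm_self ip k _ h1, add_zero]
  exact LinearMap.mem_range_self _ _

/-- Preimages under `δ_0` are chosen linearly, so that the choice extends pointwise to smooth forms.
-/
theorem exists_ceAdjoint_comp (k : ℕ) : ∃ S : Covector L (k + 1) →ₗ[ℝ] Covector L (k + 1),
    ∀ η, ceAdjoint ip k (S η) = cePartialInverse ip k η := by
  obtain ⟨S, hS⟩ := Module.projective_lifting_property (ceAdjoint ip k).rangeRestrict
    ((cePartialInverse ip k).codRestrict (LinearMap.range (ceAdjoint ip k))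
      fun η => range_cePartialInverse_le ip k (LinearMap.mem_range_self _ η))
    (LinearMap.surjective_rangeRestrict _)
  exact ⟨S, fun η => congrArg Subtype.val (LinearMap.congr_fun hS η)⟩

end PartialInverse

/-! ### Dilations, and the compatibility of `d_0⁻¹` with weights. -/

section Dilation

variable {L : Type*} [LieRing L] [LieAlgebra ℝ L] (gr : PositiveGrading L)

theorem PositiveGrading.symm_apply_of_mem {w : ℕ} {x : L} (hx : x ∈ gr.layer w) :
    (LinearEquiv.ofBijective (DirectSum.coeLinearMap gr.layer) gr.isInternal).symm x =
      DirectSum.lof ℝ ℕ (fun v => gr.layer v) w ⟨x, hx⟩ := by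
  rw [LinearEquiv.symm_apply_eq]
  exact (DirectSum.coeLinearMap_lof gr.layer w ⟨x, hx⟩).symm

theorem PositiveGrading.proj_of_mem {w : ℕ} {x : L} (hx : x ∈ gr.layer w) (v : ℕ) :
    gr.proj v x = if w = v then x else 0 := by
  simp only [PositiveGrading.proj, LinearMap.comp_apply, LinearEquiv.coe_coe,
    gr.symm_apply_of_mem hx]
  split_ifs with h
  · subst h
    rw [DirectSum.component.lof_self]
    rfl
  · rw [DirectSum.component.of, dif_neg h, map_zero]

/-- The dilation of the Lie algebra, equal to `2 ^ w` on the layer of weight `w`. -/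
def PositiveGrading.dilation : L →ₗ[ℝ] L :=
  DirectSum.toModule ℝ ℕ L (fun w => (2 ^ w : ℝ) • (gr.layer w).subtype) ∘ₗ
    (LinearEquiv.ofBijective (DirectSum.coeLinearMap gr.layer) gr.isInternal).symm.toLinearMap

theorem PositiveGrading.dilation_of_mem {w : ℕ} {x : L} (hx : x ∈ gr.layer w) :
    gr.dilation x = (2 ^ w : ℝ) • x := by
  simp only [PositiveGrading.dilation, LinearMap.comp_apply, LinearEquiv.coe_coe,
    gr.symm_apply_of_mem hx, DirectSum.toModule_lof]
  rfl

/-- The action of the dilation on left-invariant forms. -/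
def dilate (k : ℕ) : Module.End ℝ (Covector L k) where
  toFun ξ := ξ.compLinearMap gr.dilation
  map_add' _ _ := rfl
  map_smul' _ _ := rfl

theorem dilate_apply {k : ℕ} (ξ : Covector L k) (v : Fin k → L) :
    dilate gr k ξ v = ξ (fun a => gr.dilation (v a)) := rfl

variable [FiniteDimensional ℝ L]
variable {gr} (ip : AdaptedScalarProduct gr)

/-- The weight of the `i`-th vector of the graded basis. -/
def basisWeight (i : Fin (Module.finrank ℝ L)) : ℕ := (gradedBasis_mem ip i).choose

theorem gradedBasis_mem_basisWeight (i : Fin (Module.finrank ℝ L)) :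
    gradedBasis ip i ∈ gr.layer (basisWeight ip i) := (gradedBasis_mem ip i).choose_spec

theorem basisWeight_pos (i : Fin (Module.finrank ℝ L)) : 0 < basisWeight ip i := by
  refine Nat.pos_of_ne_zero fun h => (gradedBasis ip).ne_zero i ?_
  have := gradedBasis_mem_basisWeight ip i
  rwa [h, gr.layer_zero, Submodule.mem_bot] at this

theorem dilation_lie (ip : AdaptedScalarProduct gr) (x y : L) :
    gr.dilation ⁅x, y⁆ = ⁅gr.dilation x, gr.dilation y⁆ := by
  have h : (LieModule.toEnd ℝ L L : L →ₗ[ℝ] Module.End ℝ L).compr₂ gr.dilation =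
      (LieModule.toEnd ℝ L L : L →ₗ[ℝ] Module.End ℝ L).compl₁₂ gr.dilation gr.dilation := by
    refine LinearMap.ext_basis (gradedBasis ip) (gradedBasis ip) fun i j => ?_
    have hi := gradedBasis_mem_basisWeight ip i
    have hj := gradedBasis_mem_basisWeight ip j
    change gr.dilation ⁅gradedBasis ip i, gradedBasis ip j⁆ =
      ⁅gr.dilation (gradedBasis ip i), gr.dilation (gradedBasis ip j)⁆
    rw [gr.dilation_of_mem (gr.lie_mem _ _ _ _ hi hj), gr.dilation_of_mem hi,
      gr.dilation_of_mem hj, smul_lie, lie_smul, smul_smul, pow_add]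
  exact LinearMap.congr_fun₂ h x y

theorem dilate_gradedBasis {k : ℕ} (ξ : Covector L k) (i : Fin k → Fin (Module.finrank ℝ L)) :
    dilate gr k ξ (fun a => gradedBasis ip (i a)) =
      2 ^ (∑ a, basisWeight ip (i a)) * ξ (fun a => gradedBasis ip (i a)) := by
  rw [dilate_apply]
  simp only [gr.dilation_of_mem (gradedBasis_mem_basisWeight ip _)]
  rw [ξ.map_smul_univ, Finset.prod_pow_eq_pow_sum, smul_eq_mul]

theorem covectorForm_dilate {k : ℕ} (ξ η : Covector L k) :
    covectorForm ip k (dilate gr k ξ) η = covectorForm ip k ξ (dilate gr k η) := by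
  simp only [covectorForm_apply, dilate_gradedBasis]
  congr 1
  exact Finset.sum_congr rfl fun i _ => by ring

theorem dilate_ceDiff (ip : AdaptedScalarProduct gr) (k : ℕ) (ξ : Covector L k) :
    dilate gr (k + 1) (ceDiff k ξ) = ceDiff k (dilate gr k ξ) := by
  cases k with
  | zero => exact map_zero _
  | succ k =>
    ext v
    rw [dilate_apply, ceDiff_apply, ceDiff_apply]
    congr 1
    refine Finset.sum_congr rfl fun i _ => Finset.sum_congr rfl fun j _ => ?_
    rw [dilate_apply]
    congr 2
    ext a
    refine Fin.cases ?_ (fun a => ?_) a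
    · exact (dilation_lie ip _ _).symm
    · rfl

/-- The dilation commutes with `d_0` and is self-adjoint, so it preserves `(ker d_0)^⊥` and `(Im
d_0)^⊥`, the two spaces that determine `d_0⁻¹`. -/
theorem dilate_cePartialInverse (k : ℕ) (η : Covector L (k + 1)) :
    dilate gr k (cePartialInverse ip k η) = cePartialInverse ip k (dilate gr (k + 1) η) := by
  obtain ⟨ξ, hξ, η', hη', rfl⟩ := exists_ceDiff_add ip η
  have h1 : dilate gr k ξ ∈ (covectorForm ip k).orthogonal (LinearMap.ker (ceDiff k)) := by
    intro κ hκ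
    change covectorForm ip k κ (dilate gr k ξ) = 0
    rw [← covectorForm_dilate]
    refine hξ _ (LinearMap.mem_ker.2 ?_)
    rw [← dilate_ceDiff ip, LinearMap.mem_ker.1 hκ, map_zero]
  have h2 : dilate gr (k + 1) η' ∈
      (covectorForm ip (k + 1)).orthogonal (LinearMap.range (ceDiff k)) := by
    rintro _ ⟨κ, rfl⟩
    change covectorForm ip (k + 1) (ceDiff k κ) (dilate gr (k + 1) η') = 0
    rw [← covectorForm_dilate, dilate_ceDiff ip]
    exact hη' _ (LinearMap.mem_range_self _ _)
  simp only [map_add]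
  rw [dilate_ceDiff ip, cePartialInverse_ceDiff ip h1, cePartialInverse_ceDiff ip hξ,
    (cePartialInverse_eq_zero_iff ip).2 hη', (cePartialInverse_eq_zero_iff ip).2 h2, map_zero]

theorem aeval_comm_of_comm {V W : Type*} [AddCommGroup V] [Module ℝ V] [AddCommGroup W]
    [Module ℝ W] (T : V →ₗ[ℝ] W) (A : Module.End ℝ V) (B : Module.End ℝ W)
    (h : ∀ x, T (A x) = B (T x)) (f : Polynomial ℝ) (x : V) :
    T (Polynomial.aeval A f x) = Polynomial.aeval B f (T x) := by
  induction f using Polynomial.induction_on generalizing x with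
  | C a => simp
  | add p q hp hq => simp [hp, hq]
  | monomial m a ih =>
    rw [pow_succ, ← mul_assoc, map_mul _ _ Polynomial.X, map_mul _ _ Polynomial.X,
      Polynomial.aeval_X, Polynomial.aeval_X, Module.End.mul_apply, Module.End.mul_apply, ih, h]

theorem aeval_dilate_gradedBasis {k : ℕ} (f : Polynomial ℝ) (ξ : Covector L k)
    (i : Fin k → Fin (Module.finrank ℝ L)) :
    Polynomial.aeval (dilate gr k) f ξ (fun a => gradedBasis ip (i a)) =
      f.eval (2 ^ (∑ a, basisWeight ip (i a))) * ξ (fun a => gradedBasis ip (i a)) := by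
  let ev : Covector L k →ₗ[ℝ] ℝ :=
    { toFun := fun ξ => ξ (fun a => gradedBasis ip (i a))
      map_add' := fun _ _ => rfl
      map_smul' := fun _ _ => rfl }
  have h := aeval_comm_of_comm ev (dilate gr k)
    (algebraMap ℝ (Module.End ℝ ℝ) (2 ^ (∑ a, basisWeight ip (i a))))
    (fun ξ => by rw [Module.algebraMap_end_apply]; exact dilate_gradedBasis ip ξ i) f ξ
  rwa [Polynomial.aeval_algebraMap_apply, Module.algebraMap_end_apply] at h

theorem covector_ext_gradedBasis {k : ℕ} {ξ η : Covector L k}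
    (h : ∀ i : Fin k → Fin (Module.finrank ℝ L),
      ξ (fun a => gradedBasis ip (i a)) = η (fun a => gradedBasis ip (i a))) : ξ = η :=
  AlternatingMap.coe_multilinearMap_injective
    (Module.Basis.ext_multilinear (fun _ => gradedBasis ip) h)

/-- The partial inverse of `d_0` does not decrease weights. -/
theorem cePartialInverse_weight {k p : ℕ} {η : Covector L (k + 1)}
    (hη : ∀ i : Fin (k + 1) → Fin (Module.finrank ℝ L), ∑ a, basisWeight ip (i a) < p →
      η (fun a => gradedBasis ip (i a)) = 0)
    (i : Fin k → Fin (Module.finrank ℝ L)) (hi : ∑ a, basisWeight ip (i a) < p) :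
    cePartialInverse ip k η (fun a => gradedBasis ip (i a)) = 0 := by
  -- `M` is a crude bound for all weights in degree `k + 1`. The polynomial `f` vanishes at the
  -- dilation eigenvalues `2 ^ q` with `p ≤ q ≤ M`, so `f` of the dilation kills `η`, hence also
  -- `d_0⁻¹ η`; but `f` is nonzero at every eigenvalue of weight below `p`.
  let M := ∑ i : Fin (k + 1) → Fin (Module.finrank ℝ L), ∑ a, basisWeight ip (i a)
  let f : Polynomial ℝ := ∏ q ∈ Finset.Icc p M, (Polynomial.X - Polynomial.C (2 ^ q))
  have h : Polynomial.aeval (dilate gr (k + 1)) f η = 0 := by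
    refine covector_ext_gradedBasis ip fun j => ?_
    rw [aeval_dilate_gradedBasis, AlternatingMap.zero_apply]
    rcases lt_or_ge (∑ a, basisWeight ip (j a)) p with hj | hj
    · rw [hη j hj, mul_zero]
    · rw [Polynomial.eval_prod, Finset.prod_eq_zero (i := ∑ a, basisWeight ip (j a)), zero_mul]
      · exact Finset.mem_Icc.2 ⟨hj, Finset.single_le_sum (f := fun i : Fin (k + 1) → _ =>
          ∑ a, basisWeight ip (i a)) (fun _ _ => Nat.zero_le _) (Finset.mem_univ j)⟩
      · simp
  have h' := aeval_comm_of_comm (cePartialInverse ip k) (dilate gr (k + 1)) (dilate gr k)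
    (fun η => (dilate_cePartialInverse ip k η).symm) f η
  rw [h, map_zero] at h'
  have h2 := aeval_dilate_gradedBasis ip f (cePartialInverse ip k η) i
  rw [← h', AlternatingMap.zero_apply, eq_comm, mul_eq_zero] at h2
  refine h2.resolve_left ?_
  rw [Polynomial.eval_prod]
  refine Finset.prod_ne_zero_iff.2 fun q hq => ?_
  rw [Polynomial.eval_sub, Polynomial.eval_X, Polynomial.eval_C, sub_ne_zero]
  exact (pow_lt_pow_right₀ one_lt_two (hi.trans_le (Finset.mem_Icc.1 hq).1)).ne

end Dilation

/-! ### Degrees of forms under raising and lowering operators. -/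

section Degree

variable {n : ℕ} {G : Type*} [TopologicalSpace G] [ChartedSpace (EuclideanSpace ℝ (Fin n)) G]
  [Group G]

theorem mem_formsOfDegree_iff {k : ℕ} {α : Form n G} :
    α ∈ formsOfDegree n G k ↔ ∀ j, j ≠ k → α j = 0 := by
  constructor
  · rintro ⟨β, rfl⟩ j hj
    exact Pi.single_eq_of_ne hj β
  · intro h
    refine ⟨α k, funext fun j => ?_⟩
    rcases eq_or_ne j k with rfl | hj
    · exact Pi.single_eq_same _ _
    · rw [h j hj]
      exact Pi.single_eq_of_ne hj _

theorem raising_mem_formsOfDegree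
    (T : (k : ℕ) → SmoothForm n G k →ₗ[ℝ] SmoothForm n G (k + 1)) {k : ℕ} {α : Form n G}
    (hα : α ∈ formsOfDegree n G k) : raising T α ∈ formsOfDegree n G (k + 1) := by
  rw [mem_formsOfDegree_iff] at hα ⊢
  intro j hj
  cases j with
  | zero => rfl
  | succ j =>
    change T j (α j) = 0
    rw [hα j (by omega), map_zero]

theorem lowering_mem_formsOfDegree
    (T : (k : ℕ) → SmoothForm n G (k + 1) →ₗ[ℝ] SmoothForm n G k) {k : ℕ} {α : Form n G}
    (hα : α ∈ formsOfDegree n G (k + 1)) : lowering T α ∈ formsOfDegree n G k := by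
  rw [mem_formsOfDegree_iff] at hα ⊢
  intro j hj
  change T j (α (j + 1)) = 0
  rw [hα (j + 1) (by omega), map_zero]

end Degree

section Forms

variable {n : ℕ} {G : Type*} [TopologicalSpace G] [ChartedSpace (EuclideanSpace ℝ (Fin n)) G]
  [Group G] [LieGroup (𝓡 n) ∞ G]

/-! ### Pointwise operators -/

theorem smoothForm_ext {k : ℕ} {α β : SmoothForm n G k} (h : ∀ x, evalAt x α = evalAt x β) :
    α = β := by
  ext v x
  exact DFunLike.congr_fun (h x) v

theorem extDer_sub_d0 : extDer n G - d0 n G = raising fun k => derivWedge LinearMap.id k := by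
  ext α : 1
  exact add_sub_cancel_right ((raising fun k => derivWedge LinearMap.id k) α) (d0 n G α)

variable {gr : PositiveGrading (LieAlg n G)} (ip : AdaptedScalarProduct gr)

theorem d0_d0 (α : Form n G) : d0 n G (d0 n G α) = 0 := by
  funext k
  match k with
  | 0 => rfl
  | 1 => exact map_zero (extendPointwise (ceDiff 0))
  | k + 2 => exact smoothForm_ext fun x => ceDiff_ceDiff k (evalAt x (α k))

theorem d0_d0inv_d0 (α : Form n G) : d0 n G (d0inv ip (d0 n G α)) = d0 n G α := by
  funext k
  match k with
  | 0 => rfl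
  | k + 1 => exact smoothForm_ext fun x => ceDiff_cePartialInverse_ceDiff ip (evalAt x (α k))

theorem d0inv_d0_d0inv (α : Form n G) : d0inv ip (d0 n G (d0inv ip α)) = d0inv ip α :=
  funext fun k => smoothForm_ext fun x =>
    cePartialInverse_ceDiff_cePartialInverse ip (evalAt x (α (k + 1)))

theorem d0inv_d0inv (α : Form n G) : d0inv ip (d0inv ip α) = 0 :=
  funext fun k => smoothForm_ext fun x =>
    cePartialInverse_cePartialInverse ip (evalAt x (α (k + 2)))

theorem d0inv_eq_zero_iff {α : Form n G} : d0inv ip α = 0 ↔ delta0 ip α = 0 := by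
  constructor
  · exact fun h => funext fun k => smoothForm_ext fun x =>
      (cePartialInverse_eq_zero_iff_ceAdjoint ip).1 (congrArg (evalAt x) (congrFun h k))
  · exact fun h => funext fun k => smoothForm_ext fun x =>
      (cePartialInverse_eq_zero_iff_ceAdjoint ip).2 (congrArg (evalAt x) (congrFun h k))

theorem d0inv_mem_range_delta0 (α : Form n G) : d0inv ip α ∈ LinearMap.range (delta0 ip) := by
  choose S hS using exists_ceAdjoint_comp ip
  -- The component of degree `0` is arbitrary: a lowering operator never reads it.
  refine ⟨fun k => match k with
    | 0 => 0
    | k + 1 => extendPointwise (S k) (α (k + 1)), ?_⟩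
  exact funext fun k => smoothForm_ext fun x => hS k (evalAt x (α (k + 1)))

theorem projE0_apply (α : Form n G) :
    projE0 ip α = α - d0 n G (d0inv ip α) - d0inv ip (d0 n G α) := rfl

theorem projE0_d0 (α : Form n G) : projE0 ip (d0 n G α) = 0 := by
  rw [projE0_apply, d0_d0inv_d0, d0_d0, map_zero, sub_self, sub_zero]

theorem d0_projE0 (α : Form n G) : d0 n G (projE0 ip α) = 0 := by
  rw [projE0_apply, map_sub, map_sub, d0_d0, d0_d0inv_d0, sub_zero, sub_self]

theorem delta0_projE0 (α : Form n G) : delta0 ip (projE0 ip α) = 0 := by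
  rw [← d0inv_eq_zero_iff, projE0_apply, map_sub, map_sub, d0inv_d0_d0inv, d0inv_d0inv, sub_self,
    sub_zero]

/-! ### Degrees -/

theorem extDer_sub_d0_mem_formsOfDegree {k : ℕ} {α : Form n G} (hα : α ∈ formsOfDegree n G k) :
    (extDer n G - d0 n G) α ∈ formsOfDegree n G (k + 1) := by
  rw [extDer_sub_d0]
  exact raising_mem_formsOfDegree _ hα

theorem stepOp_pow_mem_formsOfDegree {k : ℕ} {α : Form n G} (hα : α ∈ formsOfDegree n G k)
    (m : ℕ) : (stepOp ip ^ m) α ∈ formsOfDegree n G k := by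
  induction m with
  | zero => exact hα
  | succ m ih =>
    rw [pow_succ', Module.End.mul_apply]
    exact lowering_mem_formsOfDegree (fun k => extendPointwise (cePartialInverse ip k))
      (extDer_sub_d0_mem_formsOfDegree ih)

theorem projE0_mem_formsOfDegree {k : ℕ} {α : Form n G} (hα : α ∈ formsOfDegree n G (k + 1)) :
    projE0 ip α ∈ formsOfDegree n G (k + 1) := by
  rw [projE0_apply]
  exact sub_mem (sub_mem hα (raising_mem_formsOfDegree _ (lowering_mem_formsOfDegree _ hα)))
    (lowering_mem_formsOfDegree _ (raising_mem_formsOfDegree _ hα))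

theorem projE0_mem_RuminForms {k : ℕ} {α : Form n G} (hα : α ∈ formsOfDegree n G (k + 1)) :
    projE0 ip α ∈ RuminForms ip (k + 1) :=
  ⟨⟨d0_projE0 ip α, delta0_projE0 ip α⟩, projE0_mem_formsOfDegree ip hα⟩

/-! ### The filtration by weight -/

/-- The forms of weight at least `p`. -/
def weightFiltration (p : ℕ) : Submodule ℝ (Form n G) where
  carrier := {α | ∀ (k : ℕ) (i : Fin k → Fin (Module.finrank ℝ (LieAlg n G))),
    ∑ a, basisWeight ip (i a) < p → α k (fun a => gradedBasis ip (i a)) = 0}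
  add_mem' {α β} hα hβ k i hi := by
    change α k _ + β k _ = 0
    rw [hα k i hi, hβ k i hi, add_zero]
  zero_mem' _ _ _ := rfl
  smul_mem' c α hα k i hi := by
    change c • α k _ = 0
    rw [hα k i hi, smul_zero]

theorem weightFiltration_zero (α : Form n G) : α ∈ weightFiltration ip 0 :=
  fun _ _ h => absurd h (Nat.not_lt_zero _)

theorem weightFiltration_anti {p q : ℕ} (h : p ≤ q) {α : Form n G}
    (hα : α ∈ weightFiltration ip q) : α ∈ weightFiltration ip p :=
  fun k i hi => hα k i (hi.trans_le h)

/-- The largest weight of the Lie algebra. -/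
def maxWeight : ℕ := Finset.univ.sup (basisWeight ip)

theorem basisWeight_le (i : Fin (Module.finrank ℝ (LieAlg n G))) :
    basisWeight ip i ≤ maxWeight ip :=
  Finset.le_sup (f := basisWeight ip) (Finset.mem_univ i)

/-- A bound for the weights of forms. -/
def maxFormWeight : ℕ := Module.finrank ℝ (LieAlg n G) * maxWeight ip

/-- An alternating form is determined by its values on distinct basis vectors. There are at most
`dim G` of these, each of weight at most `maxWeight`. -/
theorem eq_zero_of_mem_weightFiltration {p : ℕ} (hp : maxFormWeight ip < p) {α : Form n G}
    (hα : α ∈ weightFiltration ip p) : α = 0 := by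
  funext k
  refine Module.Basis.ext_alternating (gradedBasis ip) fun i hi => ?_
  refine hα k i (lt_of_le_of_lt ?_ hp)
  refine (Finset.sum_le_card_nsmul _ _ (maxWeight ip) fun a _ => basisWeight_le ip (i a)).trans ?_
  rw [smul_eq_mul]
  refine Nat.mul_le_mul_right _ ?_
  simpa using Fintype.card_le_of_injective i hi

theorem d0inv_mem_weightFiltration {p : ℕ} {α : Form n G} (hα : α ∈ weightFiltration ip p) :
    d0inv ip α ∈ weightFiltration ip p := by
  intro k i hi
  ext x
  exact cePartialInverse_weight ip (η := evalAt x (α (k + 1)))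
    (fun j hj => DFunLike.congr_fun (hα (k + 1) j hj) x) i hi

theorem dWeight_mem_weightFiltration {p w : ℕ} (hw : 1 ≤ w) {α : Form n G}
    (hα : α ∈ weightFiltration ip p) : dWeight gr w α ∈ weightFiltration ip (p + w) := by
  obtain ⟨w, rfl⟩ := Nat.exists_eq_add_of_le' hw
  intro k i hi
  cases k with
  | zero => rfl
  | succ k =>
    change derivWedge (gr.proj (w + 1)) k (α k) _ = 0
    rw [derivWedge_apply]
    refine Finset.sum_eq_zero fun a _ => ?_
    rw [gr.proj_of_mem (gradedBasis_mem_basisWeight ip (i a))]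
    split_ifs with h
    -- The differentiated direction takes up exactly weight `w + 1`, so the remaining arguments have
    -- total weight below `p`.
    · rw [Fin.sum_univ_succAbove _ a, h] at hi
      have := hα k (fun b => i (a.succAbove b)) (by omega)
      change _ • invariantDeriv (gradedBasis ip (i a))
        (α k fun b => gradedBasis ip (i (a.succAbove b))) = 0
      rw [this, map_zero, smul_zero]
    · rw [map_zero, LinearMap.zero_apply, smul_zero]

theorem derivWedge_sum {ι : Type*} (s : Finset ι) (p : ι → LieAlg n G →ₗ[ℝ] LieAlg n G) (k : ℕ) :
    derivWedge (G := G) (∑ w ∈ s, p w) k = ∑ w ∈ s, derivWedge (p w) k := by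
  refine map_sum (⟨⟨fun p => derivWedge p k, ?_⟩, fun p q => ?_⟩ :
    (LieAlg n G →ₗ[ℝ] LieAlg n G) →+ (SmoothForm n G k →ₗ[ℝ] SmoothForm n G (k + 1))) p s
  · ext α X x
    simp [derivWedge_apply]
  · ext α X x
    simp [derivWedge_apply, Finset.sum_add_distrib]

theorem sum_proj {R : ℕ} (hR : maxWeight ip ≤ R) :
    ∑ w ∈ Finset.Icc 1 R, gr.proj w = LinearMap.id := by
  refine (gradedBasis ip).ext fun i => ?_
  rw [LinearMap.sum_apply, LinearMap.id_apply]
  simp only [gr.proj_of_mem (gradedBasis_mem_basisWeight ip i)]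
  rw [Finset.sum_ite_eq, if_pos]
  exact Finset.mem_Icc.2 ⟨basisWeight_pos ip i, (basisWeight_le ip i).trans hR⟩

theorem dWeight_apply_succ {w : ℕ} (hw : 1 ≤ w) (α : Form n G) (k : ℕ) :
    dWeight gr w α (k + 1) = derivWedge (gr.proj w) k (α k) := by
  obtain ⟨w, rfl⟩ := Nat.exists_eq_add_of_le' hw
  rfl

theorem dWeight_apply_zero {w : ℕ} (hw : 1 ≤ w) (α : Form n G) : dWeight gr w α 0 = 0 := by
  obtain ⟨w, rfl⟩ := Nat.exists_eq_add_of_le' hw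
  rfl

theorem sum_dWeight {R : ℕ} (hR : maxWeight ip ≤ R) :
    ∑ w ∈ Finset.Icc 1 R, dWeight gr w = extDer n G - d0 n G := by
  rw [extDer_sub_d0]
  ext α : 1
  funext k
  rw [LinearMap.sum_apply, Finset.sum_apply]
  cases k with
  | zero => exact Finset.sum_eq_zero fun w hw => dWeight_apply_zero (Finset.mem_Icc.1 hw).1 α
  | succ k =>
    rw [Finset.sum_congr rfl fun w hw => dWeight_apply_succ (Finset.mem_Icc.1 hw).1 α k]
    change _ = derivWedge LinearMap.id k (α k)
    rw [← sum_proj ip hR, derivWedge_sum, LinearMap.sum_apply]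

theorem extDer_sub_d0_mem_weightFiltration {p : ℕ} {α : Form n G}
    (hα : α ∈ weightFiltration ip p) : (extDer n G - d0 n G) α ∈ weightFiltration ip (p + 1) := by
  rw [← sum_dWeight ip le_rfl, LinearMap.sum_apply]
  refine sum_mem fun w hw => ?_
  have h1 := (Finset.mem_Icc.1 hw).1
  exact weightFiltration_anti ip (by omega) (dWeight_mem_weightFiltration ip h1 hα)

theorem stepOp_pow_mem_weightFiltration (α : Form n G) (m : ℕ) :
    (stepOp ip ^ m) α ∈ weightFiltration ip m := by
  induction m with
  | zero => exact weightFiltration_zero ip α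
  | succ m ih =>
    rw [pow_succ', Module.End.mul_apply]
    exact d0inv_mem_weightFiltration ip (extDer_sub_d0_mem_weightFiltration ip ih)

/-- Each application of `P` gains at least one unit of weight. -/
theorem stepOp_pow_eq_zero : stepOp ip ^ (maxFormWeight ip + 1) = 0 :=
  LinearMap.ext fun α => eq_zero_of_mem_weightFiltration ip (Nat.lt_succ_self _)
    (stepOp_pow_mem_weightFiltration ip α _)

/-- In `d_{r-j} d_0⁻¹ ∂_j` the gains `j` and `r - j` add up to `r`. -/
theorem partialOp_mem_weightFiltration (α : Form n G) (r : ℕ) (hr : 1 ≤ r) :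
    partialOp ip r α ∈ weightFiltration ip r := by
  induction r using Nat.strong_induction_on with
  | _ r ih =>
    rw [partialOp_eq, LinearMap.sub_apply, LinearMap.sum_apply]
    refine sub_mem ?_ (sum_mem fun j hj => ?_)
    · simpa using dWeight_mem_weightFiltration ip hr (weightFiltration_zero ip α)
    · have hj' := Finset.mem_Ico.1 hj
      have := dWeight_mem_weightFiltration ip (w := r - j) (by omega)
        (d0inv_mem_weightFiltration ip (ih j hj'.2 hj'.1))
      rwa [Nat.add_sub_cancel' hj'.2.le] at this

theorem partialOp_eq_zero {r : ℕ} (hr : maxFormWeight ip < r) : partialOp ip r = 0 :=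
  LinearMap.ext fun α => eq_zero_of_mem_weightFiltration ip hr
    (partialOp_mem_weightFiltration ip α r (by omega))

end Forms

/-! ### Linear algebra: Neumann series and the summed recursion. -/

section Nilpotent

variable {V : Type*} [AddCommGroup V] [Module ℝ V]

theorem isUnit_one_add_of_pow_eq_zero {T : Module.End ℝ V} {m : ℕ} (h : T ^ m = 0) :
    IsUnit (1 + T) :=
  IsNilpotent.isUnit_one_add ⟨m, h⟩

theorem neg_one_pow_succ_smul (m : ℕ) (x : V) : (-1 : ℝ) ^ (m + 1) • x = -((-1 : ℝ) ^ m • x) := by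
  rw [pow_succ, mul_neg_one, neg_smul]

theorem neumann_add_apply_neumann {T : Module.End ℝ V} {x : V} {N : ℕ}
    (h : (T ^ (N + 1)) x = 0) :
    ∑ i ∈ Finset.range (N + 1), (-1 : ℝ) ^ i • (T ^ i) x +
      T (∑ i ∈ Finset.range (N + 1), (-1 : ℝ) ^ i • (T ^ i) x) = x := by
  have h1 : T (∑ i ∈ Finset.range (N + 1), (-1 : ℝ) ^ i • (T ^ i) x) =
      ∑ i ∈ Finset.range (N + 1), (-1 : ℝ) ^ i • (T ^ (i + 1)) x := by
    rw [map_sum]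
    refine Finset.sum_congr rfl fun i _ => ?_
    rw [map_smul, pow_succ', Module.End.mul_apply]
  rw [h1, Finset.sum_range_succ (fun i => (-1 : ℝ) ^ i • (T ^ (i + 1)) x), h, smul_zero, add_zero, Finset.sum_range_succ']
  simp only [neg_one_pow_succ_smul, Finset.sum_neg_distrib, pow_zero, one_smul,
    Module.End.one_apply]
  abel

/-- If `y_r = d_r x - ∑_{1 ≤ j < r} d_{r-j} J y_j` and `D = ∑ d_r`, then `s + D J s = D x` for `s`
the sum of sufficiently many of the `y_r`. -/
theorem sum_add_apply_sum_of_recursion {d : ℕ → Module.End ℝ V} {J D : Module.End ℝ V} {x : V}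
    {y : ℕ → V} {M W R : ℕ} (hd : ∀ R, W ≤ R → ∑ r ∈ Finset.Icc 1 R, d r = D)
    (hy : ∀ r, y r = d r x - ∑ j ∈ Finset.Ico 1 r, d (r - j) (J (y j)))
    (h0 : ∀ j, M < j → y j = 0) (hR : M + W ≤ R) :
    ∑ r ∈ Finset.Icc 1 R, y r + D (J (∑ r ∈ Finset.Icc 1 R, y r)) = D x := by
  have h : ∑ r ∈ Finset.Icc 1 R, y r =
      D x - ∑ r ∈ Finset.Icc 1 R, ∑ j ∈ Finset.Ico 1 r, d (r - j) (J (y j)) := by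
    rw [Finset.sum_congr rfl fun r _ => hy r, Finset.sum_sub_distrib, ← hd R (by omega),
      LinearMap.sum_apply]
  have h2 : ∑ r ∈ Finset.Icc 1 R, ∑ j ∈ Finset.Ico 1 r, d (r - j) (J (y j)) =
        D (J (∑ r ∈ Finset.Icc 1 R, y r)) := by
    -- With `j` outermost, the inner sum is `∑_{w=1}^{R-j} d_w` applied to `J (y j)`.
    rw [Finset.sum_comm' (t' := Finset.Icc 1 R) (s' := fun j => Finset.Ioc j R)
      (fun r j => by simp only [Finset.mem_Icc, Finset.mem_Ico, Finset.mem_Ioc]; omega),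
      map_sum, map_sum]
    refine Finset.sum_congr rfl fun j hj => ?_
    -- Truncation is harmless: either `y j = 0`, or `R - j ≥ W` and the inner sum is all of `D`.
    rcases lt_or_ge M j with hj' | hj'
    · simp [h0 j hj']
    · rw [← hd (R - j) (by omega), LinearMap.sum_apply]
      refine Finset.sum_nbij' (fun r => r - j) (fun w => w + j) ?_ ?_ ?_ ?_ fun _ _ => rfl
      all_goals
        intro a ha
        simp only [Finset.mem_Ioc, Finset.mem_Icc] at ha ⊢
        have := (Finset.mem_Icc.1 hj).2
        omega
  rw [h2] at h
  rw [← eq_sub_iff_add_eq]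
  exact h

end Nilpotent

/-! ### The Neumann series of `P` and the sum of the `∂_r`. -/

section Recursion

variable {n : ℕ} {G : Type*} [TopologicalSpace G] [ChartedSpace (EuclideanSpace ℝ (Fin n)) G]
  [Group G] [LieGroup (𝓡 n) ∞ G] {gr : PositiveGrading (LieAlg n G)}
  (ip : AdaptedScalarProduct gr)

theorem stepOp_apply (α : Form n G) :
    stepOp ip α = d0inv ip ((extDer n G - d0 n G) α) := rfl

theorem one_sub_bOp : 1 - bOp ip = 1 + stepOp ip := by
  ext α : 1
  change α - (d0inv ip (d0 n G α) - d0inv ip (extDer n G α)) =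
    α + d0inv ip (extDer n G α - d0 n G α)
  rw [map_sub]
  abel

theorem isUnit_one_sub_bOp : IsUnit (1 - bOp ip) := by
  rw [one_sub_bOp]
  exact isUnit_one_add_of_pow_eq_zero (stepOp_pow_eq_zero ip)

theorem partialSum_apply (N : ℕ) (α : Form n G) :
    partialSum ip N α = ∑ r ∈ Finset.Icc 1 N, partialOp ip r α := LinearMap.sum_apply _ _ _

theorem partialSum_add {R : ℕ} (hR : maxFormWeight ip + maxWeight ip ≤ R) (α : Form n G) :
    partialSum ip R α + (extDer n G - d0 n G) (d0inv ip (partialSum ip R α)) =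
      (extDer n G - d0 n G) α := by
  rw [partialSum_apply]
  refine sum_add_apply_sum_of_recursion (d := dWeight gr) (y := fun r => partialOp ip r α)
    (fun _ h => sum_dWeight ip h) (fun r => ?_) (fun r h => ?_) hR
  · rw [partialOp_eq, LinearMap.sub_apply, LinearMap.sum_apply]
    rfl
  · change partialOp ip r α = 0
    rw [partialOp_eq_zero ip h, LinearMap.zero_apply]

/-- Injectivity of `1 + D d_0⁻¹`, where `D = d - d_0`: the equation `α = -D d_0⁻¹ α` raises the
weight of `α` without end. -/
theorem eq_zero_of_add_eq_zero {α : Form n G}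
    (h : α + (extDer n G - d0 n G) (d0inv ip α) = 0) : α = 0 := by
  have key : ∀ p, α ∈ weightFiltration ip p := fun p => by
    induction p with
    | zero => exact weightFiltration_zero ip α
    | succ p ih =>
      rw [eq_neg_of_add_eq_zero_left h]
      exact neg_mem (extDer_sub_d0_mem_weightFiltration ip (d0inv_mem_weightFiltration ip ih))
  exact eq_zero_of_mem_weightFiltration ip (Nat.lt_succ_self _) (key _)

/-- The truncated Neumann series `∑_{i ≤ N} (-P)^i α`. -/
def neumannSum (α : Form n G) (N : ℕ) : Form n G :=
  ∑ i ∈ Finset.range (N + 1), (-1 : ℝ) ^ i • (stepOp ip ^ i) α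

theorem stepOp_neumannSum (α : Form n G) (N : ℕ) : stepOp ip (neumannSum ip α N) =
    ∑ i ∈ Finset.range (N + 1), (-1 : ℝ) ^ i • (stepOp ip ^ (i + 1)) α := by
  rw [neumannSum, map_sum]
  refine Finset.sum_congr rfl fun i _ => ?_
  rw [map_smul, pow_succ', Module.End.mul_apply]

variable {ip} in
theorem neumannSum_add_stepOp {α : Form n G} {N : ℕ} (h : (stepOp ip ^ (N + 1)) α = 0) :
    neumannSum ip α N + stepOp ip (neumannSum ip α N) = α :=
  neumann_add_apply_neumann h

variable {ip} in
-- Both sides solve `u + (d - d_0) d_0⁻¹ u = (d - d_0) α`, whose solution is unique. No term-by-term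
-- comparison is made.
theorem extDer_sub_d0_neumannSum {α : Form n G} {N : ℕ} (h : (stepOp ip ^ (N + 1)) α = 0)
    (h' : ∀ r > N, partialOp ip r α = 0) :
    (extDer n G - d0 n G) (neumannSum ip α N) = partialSum ip N α := by
  -- `R` is large enough for `partialSum_add` and at least `N`; the additional terms vanish by `h'`.
  set R := maxFormWeight ip + maxWeight ip + N with hR
  have hT : partialSum ip N α = partialSum ip R α := by
    simp only [partialSum_apply]
    refine Finset.sum_subset (Finset.Icc_subset_Icc_right (by omega)) fun r hr hr' => h' r ?_
    simp only [Finset.mem_Icc, not_and, not_le] at hr hr'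
    exact hr' hr.1
  have h1 := partialSum_add ip (R := R) (by omega) α
  rw [hT, ← sub_eq_zero]
  refine eq_zero_of_add_eq_zero ip ?_
  have h2 := congrArg (extDer n G - d0 n G) (neumannSum_add_stepOp h)
  rw [map_add, stepOp_apply, ← h1] at h2
  rw [map_sub, map_sub, sub_add_sub_comm, sub_eq_zero]
  exact h2

/-! ### Closed form of the Leibniz recursion. -/

theorem leibnizRec_succ (α : Form n G) (m : ℕ) :
    leibnizRec ip α (m + 1) = leibnizStep ip (leibnizRec ip α m) :=
  Function.iterate_succ_apply' _ _ _

theorem extDer_eq_leibnizRec (α : Form n G) (m : ℕ) :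
    extDer n G α = extDer n G (leibnizRec ip α m).1 + (leibnizRec ip α m).2.1 +
      (leibnizRec ip α m).2.2 := by
  induction m with
  | zero => simp [leibnizRec]
  | succ m ih =>
    rw [ih, leibnizRec_succ]
    simp only [leibnizStep, map_add, projE0_apply, LinearMap.sub_apply]
    abel

variable {ip} {k : ℕ} {α : Form n G}

theorem d0_eq_zero_of_mem_RuminForms (hα : α ∈ RuminForms ip k) : d0 n G α = 0 := hα.1.1

theorem d0inv_eq_zero_of_mem_RuminForms (hα : α ∈ RuminForms ip k) : d0inv ip α = 0 :=
  (d0inv_eq_zero_iff ip).2 hα.1.2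

theorem extDer_eq_of_mem_RuminForms (hα : α ∈ RuminForms ip k) :
    extDer n G α = (extDer n G - d0 n G) α := by
  rw [LinearMap.sub_apply, d0_eq_zero_of_mem_RuminForms hα, sub_zero]

/-- The start `ρ_0 = dα` equals `(d - d_0) α` because `d_0 α = 0`; each step then inserts one factor
`-P` to the right of `d - d_0`. -/
theorem leibnizRec_rho (hα : α ∈ RuminForms ip k) (m : ℕ) : (leibnizRec ip α m).2.2 =
    (extDer n G - d0 n G) ((-1 : ℝ) ^ m • (stepOp ip ^ m) α) := by
  induction m with
  | zero =>
    rw [pow_zero, pow_zero, one_smul, Module.End.one_apply, ← extDer_eq_of_mem_RuminForms hα]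
    rfl
  | succ m ih =>
    rw [leibnizRec_succ]
    simp only [leibnizStep]
    rw [ih, ← stepOp_apply, map_smul, ← Module.End.mul_apply, ← pow_succ', ← map_neg]
    exact congrArg _ (neg_one_pow_succ_smul m _).symm

theorem leibnizRec_eta (hα : α ∈ RuminForms ip k) (m : ℕ) : (leibnizRec ip α m).1 =
    ∑ i ∈ Finset.range m, (-1 : ℝ) ^ i • (stepOp ip ^ (i + 1)) α := by
  induction m with
  | zero => rfl
  | succ m ih =>
    rw [leibnizRec_succ, Finset.sum_range_succ, ← ih]
    simp only [leibnizStep]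
    rw [leibnizRec_rho hα, ← stepOp_apply, map_smul, ← Module.End.mul_apply, ← pow_succ']

theorem leibnizRec_zeta (hα : α ∈ RuminForms ip k) (m : ℕ) : (leibnizRec ip α (m + 1)).2.1 =
    projE0 ip ((extDer n G - d0 n G) (neumannSum ip α m)) +
      d0inv ip (d0 n G ((extDer n G - d0 n G) (neumannSum ip α m))) := by
  have key : ∀ m, (leibnizRec ip α m).2.1 =
      projE0 ip ((extDer n G - d0 n G)
        (∑ i ∈ Finset.range m, (-1 : ℝ) ^ i • (stepOp ip ^ i) α)) +
      d0inv ip (d0 n G ((extDer n G - d0 n G)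
        (∑ i ∈ Finset.range m, (-1 : ℝ) ^ i • (stepOp ip ^ i) α))) := fun m => by
    induction m with
    | zero => simp only [Finset.range_zero, Finset.sum_empty, map_zero, add_zero]; rfl
    | succ m ih =>
      rw [leibnizRec_succ, Finset.sum_range_succ]
      simp only [leibnizStep]
      rw [ih, leibnizRec_rho hα]
      simp only [map_add]
      abel
  exact key (m + 1)

/-! ### `Π_E` and `d_c` on Rumin forms. -/

/-- Since `d_0⁻¹ α = 0` and `d_0 α = 0`, the projection reduces to `Π α = (1 + P)⁻¹ P α`. With `S`
the Neumann sum, `P α = (1 + P) P S`, so `Π α = P S` and `α - P S = S`. Only `P^{N+1} α = 0` is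
needed, not `P^{N+1} = 0`. -/
theorem projE_apply_of_mem_RuminForms (hα : α ∈ RuminForms ip k) {N : ℕ}
    (h : (stepOp ip ^ (N + 1)) α = 0) : projE ip α = neumannSum ip α N := by
  have h1 : Ring.inverse (1 - bOp ip) (stepOp ip α) = stepOp ip (neumannSum ip α N) := by
    have h2 : stepOp ip α = (1 - bOp ip) (stepOp ip (neumannSum ip α N)) := by
      conv_lhs => rw [← neumannSum_add_stepOp h]
      rw [one_sub_bOp, map_add]
      rfl
    rw [h2, ← Module.End.mul_apply, Ring.inverse_mul_cancel _ (isUnit_one_sub_bOp ip)]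
    rfl
  have h3 : projF ip α = stepOp ip (neumannSum ip α N) := by
    rw [projF, LinearMap.add_apply]
    simp only [Module.End.mul_apply]
    rw [d0inv_eq_zero_of_mem_RuminForms hα, map_zero, map_zero, add_zero,
      extDer_eq_of_mem_RuminForms hα, ← stepOp_apply, h1]
  rw [projE, LinearMap.sub_apply, h3, Module.End.one_apply, sub_eq_iff_eq_add,
    neumannSum_add_stepOp h]

theorem ruminDiff_apply_of_mem_RuminForms (hα : α ∈ RuminForms ip k) {N : ℕ}
    (h : (stepOp ip ^ (N + 1)) α = 0) :
    ruminDiff ip α = projE0 ip ((extDer n G - d0 n G) (neumannSum ip α N)) := by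
  rw [ruminDiff, Module.End.mul_apply, Module.End.mul_apply, projE_apply_of_mem_RuminForms hα h,
    LinearMap.sub_apply, map_sub, projE0_d0, sub_zero]

theorem neumannSum_mem_formsOfDegree (hα : α ∈ RuminForms ip k) (N : ℕ) :
    neumannSum ip α N ∈ formsOfDegree n G k :=
  sum_mem fun i _ => Submodule.smul_mem _ _ (stepOp_pow_mem_formsOfDegree ip hα.2 i)

end Recursion

end RuminLeibniz

end

theorem mainTheorem10 {n : ℕ} {G : Type*} [TopologicalSpace G]
    [ChartedSpace (EuclideanSpace ℝ (Fin n)) G] [Group G] [LieGroup (𝓡 n) ∞ G]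
    [SimplyConnectedSpace G] (gr : PositiveGrading (LieAlg n G)) (ip : AdaptedScalarProduct gr) :
    -- the operators are well defined and the recursion terminates, uniformly on `G`
    IsUnit (1 - bOp ip) ∧
    (∃ N : ℕ, stepOp ip ^ (N + 1) = 0 ∧ ∀ r > N, partialOp ip r = 0) ∧
    ∀ (k : ℕ) (α : Form n G), α ∈ RuminForms ip k →
      -- every step of the recursion is an expression of `dα`
      (∀ m : ℕ, extDer n G α = extDer n G (leibnizRec ip α m).1 + (leibnizRec ip α m).2.1 +
        (leibnizRec ip α m).2.2) ∧
      ∀ N : ℕ, (stepOp ip ^ (N + 1)) α = 0 → (∀ r > N, partialOp ip r α = 0) →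
        -- after `N + 1` steps nothing is left to process
        (leibnizRec ip α (N + 1)).2.2 = 0 ∧
        -- the exact part: its primitive is in `Im δ_0` and equals `α - Π_E α`
        (leibnizRec ip α (N + 1)).1 =
          ∑ i ∈ Finset.range (N + 1), (-1 : ℝ) ^ i • (stepOp ip ^ (i + 1)) α ∧
        (leibnizRec ip α (N + 1)).1 ∈ LinearMap.range (delta0 ip) ∧
        projE ip α = α - (leibnizRec ip α (N + 1)).1 ∧
        -- the collected part is the Rumin differential plus a form in `Im δ_0`
        (extDer n G - d0 n G) (∑ i ∈ Finset.range (N + 1), (-1 : ℝ) ^ i • (stepOp ip ^ i) α) =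
          partialSum ip N α ∧
        projE0 ip (partialSum ip N α) = ruminDiff ip α ∧
        (leibnizRec ip α (N + 1)).2.1 =
          ruminDiff ip α + d0inv ip (d0 n G (partialSum ip N α)) ∧
        extDer n G (projE ip α) =
          ruminDiff ip α + d0inv ip (d0 n G (partialSum ip N α)) ∧
        d0inv ip (d0 n G (partialSum ip N α)) ∈ LinearMap.range (delta0 ip) ∧
        ruminDiff ip α ∈ RuminForms ip (k + 1) := by
  refine ⟨isUnit_one_sub_bOp ip,
    ⟨maxFormWeight ip, stepOp_pow_eq_zero ip, fun r hr => partialOp_eq_zero ip hr⟩,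
    fun k α hα => ⟨extDer_eq_leibnizRec ip α, fun N hN hr => ?_⟩⟩
  have hT := extDer_sub_d0_neumannSum hN hr
  have hρ : (leibnizRec ip α (N + 1)).2.2 = 0 := by
    rw [leibnizRec_rho hα, hN, smul_zero, map_zero]
  have hη : (leibnizRec ip α (N + 1)).1 = stepOp ip (neumannSum ip α N) := by
    rw [leibnizRec_eta hα, stepOp_neumannSum]
  have hc : projE0 ip (partialSum ip N α) = ruminDiff ip α := by
    rw [ruminDiff_apply_of_mem_RuminForms hα hN, hT]
  have hζ : (leibnizRec ip α (N + 1)).2.1 =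
      ruminDiff ip α + d0inv ip (d0 n G (partialSum ip N α)) := by
    rw [leibnizRec_zeta hα, hT, hc]
  have hE : projE ip α = α - (leibnizRec ip α (N + 1)).1 := by
    rw [projE_apply_of_mem_RuminForms hα hN, hη, eq_sub_iff_add_eq, neumannSum_add_stepOp hN]
  refine ⟨hρ, leibnizRec_eta hα _, ?_, hE, hT, hc, hζ, ?_, d0inv_mem_range_delta0 ip _, ?_⟩
  · rw [hη]
    exact d0inv_mem_range_delta0 ip _
  -- As `ρ_{N+1} = 0`, the invariant of the recursion reads `dα = dη_{N+1} + ζ_{N+1}`, that is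
  -- `d(Π_E α) = ζ_{N+1}`.
  · rw [hE, map_sub, ← hζ, sub_eq_iff_eq_add]
    conv_lhs => rw [extDer_eq_leibnizRec ip α (N + 1), hρ, add_zero]
    exact add_comm _ _
  · rw [ruminDiff_apply_of_mem_RuminForms hα hN]
    exact projE0_mem_RuminForms ip
      (extDer_sub_d0_mem_formsOfDegree (neumannSum_mem_formsOfDegree hα N))
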